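/- Let $a_1,a_2$ be nonzero integers such that $f(X)=X^2-a_1X+a_2$ is irreducible over $\mathbb{Q}$, let $a,b\in\overline{\mathbb{Q}}$ be its roots, and put $\gamma=a/b$, $K=\mathbb{Q}(a)$, $\Delta=a_1^2-4a_2$. Assume that $\gamma$ is not a root of unity. Let $\Delta_K$ be the absolute discriminant of $K$. For a root of unity $\zeta\in K$ let $h(\zeta)$ be the largest integer $n\ge 1$ with $\zeta\gamma\in (K^\times)^n$, let $h=\max_\zeta h(\zeta)$, and assume that $h=h(1)$. Write $(m,n)$ and $[m,n]$ for gcd and lcm; for positive integers $m,d$, write $m\mid d^\infty$ if every prime divisor of $m$ divides $d$, and $(m,d^\infty)$ for the largest divisor of $m$ that divides $d^\infty$. Put $h_2=(h,2^\infty)$. Let $[P]$ be $1$ if $P$ holds and $0$ otherwise. For $m\mid n$ let $K_{n,m}=K(\zeta_n,\gamma^{1/m})$, where $\zeta_n$ is a primitive $n$-th root of unity and $\gamma^{1/m}$ is an $m$-th root of $\gamma$ (both chosen arbitrarily). For $d\geq 1$ define $$\delta_\gamma^-(d)=\sum_{v\mid d^\infty}\ \sum_{u\mid d}\frac{\mu(u)\,[\sigma_{u,v}\text{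 exists}]}{[K_{dv,uv}:\mathbb{Q}]},$$ where "$\sigma_{u,v}$ exists" means that some $\sigma\in\mathrm{Gal}(K_{dv,uv}/\mathbb{Q})$ satisfies $\sigma(\sqrt{\Delta})=-\sqrt{\Delta}$, $\sigma(\zeta_{dv})=\zeta_{dv}^{-1}$ and $\sigma(\gamma^{1/uv})=\gamma^{-1/uv}$, with $\gamma^{-1/uv}=(\gamma^{1/uv})^{-1}$. **Theorem.** Assume $\mathcal{Q}=0$, i.e. $N_{K/\mathbb{Q}}(\gamma^{1/h_2})\neq 1$, where $\gamma^{1/h_2}$ is taken in $K$ (this forces $\Delta_K>0$). Let $d\ge 1$ be even, and let $e=\Delta_K/(d,\Delta_K)$. Then the series over $v$ defining $\delta_\gamma^-(d)$ converges absolutely and $$\delta_\gamma^-(d)=\frac{3}{2d}\left(\frac{1}{(h,d^\infty)}-[\,e\mid d^\infty\text{ and }h_2\nmid e\,]\cdot\frac{(h,d^\infty)}{[(h,d^\infty),e]^2}\right)\prod_{p\mid d}\frac{p^2}{p^2-1}.$$ -/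

import Mathlib

open scoped IntermediateField

namespace LucasRank

noncomputable section

/-- The characteristic polynomial `X² - a₁ X + a₂` of the Lucas sequence `U(a₁, a₂)`. -/
def charPoly (a₁ a₂ : ℤ) : Polynomial ℚ :=
  Polynomial.X ^ 2 - Polynomial.C (a₁ : ℚ) * Polynomial.X + Polynomial.C (a₂ : ℚ)

variable {Ω : Type*} [Field Ω] [Algebra ℚ Ω]

/-- `ℚ(a)` is a number field for every algebraic number `a`. -/
instance numberField_adjoin [Algebra.IsAlgebraic ℚ Ω] (a : Ω) : NumberField ℚ⟮a⟯ where
  to_charZero := charZero_of_injective_algebraMap (algebraMap ℚ ℚ⟮a⟯).injective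
  to_finiteDimensional := by
    have h : FiniteDimensional ℚ ℚ⟮a⟯ :=
      IntermediateField.adjoin.finiteDimensional (Algebra.IsIntegral.isIntegral a)
    convert h using 1
    exact Subsingleton.elim _ _

/-- `m ∣ d^∞`: the positive integer `m` has only prime divisors that divide `d`. -/
def DvdInfty (m d : ℕ) : Prop :=
  0 < m ∧ ∀ p : ℕ, p.Prime → p ∣ m → p ∣ d

/-- `(m, d^∞)`: the product over the primes `p ∣ d` of the exact powers of `p` dividing `m`. -/
def gcdInfty (m d : ℕ) : ℕ :=
  ∏ p ∈ d.primeFactors, p ^ padicValNat p m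

/-- The largest integer `n ≥ 1` such that `x` is the `n`-th power of an element of `Kˣ`. -/
def powerIndex (K : IntermediateField ℚ Ω) (x : Ω) : ℕ :=
  sSup {n : ℕ | 1 ≤ n ∧ ∃ y : K, y ≠ 0 ∧ (y : Ω) ^ n = x}

/-- The maximum of `h(ζ)` over the roots of unity `ζ ∈ K`, where `h(ζ)` is the largest `n ≥ 1` such
that `ζ γ` is the `n`-th power of an element of `Kˣ`. -/
def maxPowerIndex (K : IntermediateField ℚ Ω) (γ : Ω) : ℕ :=
  sSup {n : ℕ | ∃ ζ : Ω, ζ ∈ K ∧ IsOfFinOrder ζ ∧ n = powerIndex K (ζ * γ)}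

/-- The proposition `N_{K/ℚ}(γ^{1/k}) = 1`, where `γ^{1/k}` is a `k`-th root of `γ` lying in `K`. -/
def RootHasNormOne (K : IntermediateField ℚ Ω) (γ : Ω) (k : ℕ) : Prop :=
  ∃ x : K, (x : Ω) ^ k = γ ∧ Algebra.norm ℚ x = 1

/-- The field `ℚ(a)(ζ, ρ)`. With `ζ` a primitive `n`-th root of unity, `ρ` an `m`-th root of `γ`
and `m ∣ n` it is the cyclotomic-Kummer extension `K_{n,m} = K(ζ_n, γ^{1/m})` of `K = ℚ(a)`. -/
def kummerField (a ζ ρ : Ω) : IntermediateField ℚ Ω :=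
  IntermediateField.adjoin ℚ {a, ζ, ρ}

/-- There is `σ ∈ Gal(ℚ(a, ζ, ρ)/ℚ)` with `σ(√Δ) = -√Δ`, `σ(ζ) = ζ⁻¹` and `σ(ρ) = ρ⁻¹`. -/
def SigmaExists (Δ : ℤ) (a ζ ρ : Ω) : Prop :=
  ∃ (σ : kummerField a ζ ρ ≃ₐ[ℚ] kummerField a ζ ρ) (s z r : kummerField a ζ ρ),
    (s : Ω) ^ 2 = (Δ : Ω) ∧ (z : Ω) = ζ ∧ (r : Ω) = ρ ∧
      σ s = -s ∧ σ z = z⁻¹ ∧ σ r = r⁻¹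

open Classical in
/-- The inner sum `∑_{u ∣ d} μ(u) [σ_{u,v} exists] / [K_{dv,uv} : ℚ]`; here `zeta n` is the chosen
primitive `n`-th root of unity and `root m` the chosen value of `γ^{1/m}`. -/
def deltaMinusTerm (Δ : ℤ) (a : Ω) (zeta root : ℕ → Ω) (d v : ℕ) : ℝ :=
  ∑ u ∈ d.divisors,
    (ArithmeticFunction.moebius u : ℝ) *
        (if SigmaExists Δ a (zeta (d * v)) (root (u * v)) then 1 else 0) /
      (Module.finrank ℚ (kummerField a (zeta (d * v)) (root (u * v))) : ℝ)

/-- `δ⁻_γ(d) = ∑_{v ∣ d^∞} ∑_{u ∣ d} μ(u) [σ_{u,v} exists] / [K_{dv,uv} : ℚ]`. -/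
def deltaMinus (Δ : ℤ) (a : Ω) (zeta root : ℕ → Ω) (d : ℕ) : ℝ :=
  ∑' v : {v : ℕ // DvdInfty v d}, deltaMinusTerm Δ a zeta root d v

end

end LucasRank

/-!
Write `q = h₂`. The element `γ = a / b` has norm `1` over `ℚ`, so an `h`-th root `c ∈ K` of `γ` has
norm `±1`, and the hypothesis `N(γ^{1/q}) ≠ 1` forces `N(c) = -1` and `2 ∣ h`; in particular `K` is
real (`IsConjugatePair.exists_isKummerDatum`, `IsConjugatePair.complexConj_apply`). For even `n`
and `m ∣ n` two facts determine the terms of the series.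

* `σ` exists if and only if `K ⊄ ℚ(ζ_n)` and `q ∤ m` (`IsKummerDatum.sigmaExists_iff`). On `ℚ(ζ_n)`
  such a `σ` is complex conjugation, which is trivial on the real field `K`. If `q ∣ m`, then `σ`
  would give an odd power of `c` the norm `1`. Conversely, an automorphism that inverts `ζ_n` and
  moves `a` can be corrected at `γ^{1/m}` by Kummer theory.
* In this case `[K_{n,m} : ℚ] = 2 φ(n) m / (m, h)` (`IsKummerDatum.finrank_kummerField`). The point
  is that `γ` acquires no new `t`-th roots in `K(ζ_n)` when `q ∤ t`
  (`IsKummerDatum.dvd_of_pow_eq_of_mem_adjoin`): for odd `t`, the product of such a root with its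
  complex conjugate is a `t`-th root of `γ²` in `K`.

The inclusion `K ⊆ ℚ(ζ_n)` holds, for even `n`, exactly if `Δ_K ∣ n`
(`IsConjugatePair.mem_adjoin_iff_discr_dvd`). This comes from quadratic Gauss sums and from
`ℚ(ζ_m) ∩ ℚ(ζ_n) = ℚ(ζ_{(m,n)})`, together with the computation of the discriminant of `ℚ(√D)`.
For `n = d v` it means `e ∣ v`.

The term at `v` is therefore `0` if `e ∣ v`, and otherwise it is
`1 / (2 φ(d) v²) ∑_{u ∣ d} μ(u) [q ∤ u v] (u v, h) / u`. With `H = (h, d^∞)`, the sum over `u`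
factors over the primes and equals `[H ∣ 2 v and q ∤ v] H φ(d) / d` (`sum_divisors_moebius_gcd`).
The numbers `v` with `H ∣ 2 v` and `q ∤ v` are the products of `H / 2` with odd numbers
`w ∣ d^∞`, and those among them that `e` divides are described in the same way by `[H, e]`; so the
series is a difference of two Euler products (`hasSum_not_dvd_inv_sq`).
-/

namespace LucasRank

/-! ### The numbers `m ∣ d^∞` and the divisor `(m, d^∞)` -/

theorem dvdInfty_iff_mem_factoredNumbers {v d : ℕ} (hd : d ≠ 0) :
    DvdInfty v d ↔ v ∈ Nat.factoredNumbers d.primeFactors := by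
  rw [Nat.mem_factoredNumbers_iff_primeFactors_subset, DvdInfty, Nat.pos_iff_ne_zero]
  refine and_congr_right fun hv => ⟨fun h p hp => ?_, fun h p hp hpv => ?_⟩
  · have := Nat.prime_of_mem_primeFactors hp
    exact Nat.mem_primeFactors.2 ⟨this, h p this (Nat.dvd_of_mem_primeFactors hp), hd⟩
  · exact Nat.dvd_of_mem_primeFactors (h (Nat.mem_primeFactors.2 ⟨hp, hpv, hv⟩))

theorem gcdInfty_pos (m d : ℕ) : 0 < gcdInfty m d :=
  Finset.prod_pos fun _ hp => pow_pos (Nat.prime_of_mem_primeFactors hp).pos _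

theorem gcdInfty_two (m : ℕ) : gcdInfty m 2 = 2 ^ padicValNat 2 m := by
  simp [gcdInfty, Nat.prime_two.primeFactors]

theorem factorization_gcdInfty (m d p : ℕ) :
    (gcdInfty m d).factorization p = if p ∈ d.primeFactors then m.factorization p else 0 := by
  classical
  have hne : ∀ r ∈ d.primeFactors, r ^ padicValNat r m ≠ 0 := fun r hr =>
    pow_ne_zero _ (Nat.prime_of_mem_primeFactors hr).ne_zero
  rw [gcdInfty, Nat.factorization_prod hne, Finset.sum_apply']
  have : ∀ r ∈ d.primeFactors, (r ^ padicValNat r m).factorization p =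
      if p = r then m.factorization p else 0 := by
    intro r hr
    have hrp := Nat.prime_of_mem_primeFactors hr
    rw [hrp.factorization_pow, Finsupp.single_apply]
    by_cases h : r = p
    · subst h; simp [Nat.factorization_def _ hrp]
    · simp [h, Ne.symm h]
  rw [Finset.sum_congr rfl this, Finset.sum_ite_eq]

theorem gcdInfty_dvd {m : ℕ} (hm : m ≠ 0) (d : ℕ) : gcdInfty m d ∣ m := by
  rw [← Nat.factorization_le_iff_dvd (gcdInfty_pos m d).ne' hm]
  intro p
  rw [factorization_gcdInfty]
  split_ifs <;> simp

theorem dvdInfty_gcdInfty {d : ℕ} (m : ℕ) : DvdInfty (gcdInfty m d) d := by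
  refine ⟨gcdInfty_pos m d, fun p hp hpm => ?_⟩
  by_contra hpd
  have h1 := (hp.dvd_iff_one_le_factorization (gcdInfty_pos m d).ne').1 hpm
  rw [factorization_gcdInfty, if_neg fun h => hpd (Nat.dvd_of_mem_primeFactors h)] at h1
  omega

theorem dvdInfty_of_dvd {m n d : ℕ} (h : DvdInfty n d) (hmn : m ∣ n) : DvdInfty m d :=
  ⟨Nat.pos_of_dvd_of_pos hmn h.1, fun p hp hpm => h.2 p hp (hpm.trans hmn)⟩

theorem DvdInfty.mul {m n d : ℕ} (hm : DvdInfty m d) (hn : DvdInfty n d) :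
    DvdInfty (m * n) d :=
  ⟨Nat.mul_pos hm.1 hn.1, fun p hp h => ((hp.dvd_mul).1 h).elim (hm.2 p hp) (hn.2 p hp)⟩

/-- `d v` and `d` have the same prime divisors, so that `φ(d v) / (d v) = φ(d) / d`. -/
theorem totient_mul_of_dvdInfty {v d : ℕ} (h : DvdInfty v d) :
    Nat.totient (d * v) = v * Nat.totient d := by
  obtain rfl | hd := Nat.eq_zero_or_pos d
  · simp
  have hpf : (d * v).primeFactors = d.primeFactors := by
    rw [Nat.primeFactors_mul hd.ne' h.1.ne', Finset.union_eq_left]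
    exact Nat.primeFactors_subset_of_mem_factoredNumbers
      ((dvdInfty_iff_mem_factoredNumbers hd.ne').1 h)
  have h1 := Nat.totient_mul_prod_primeFactors (d * v)
  have h2 := Nat.totient_mul_prod_primeFactors d
  rw [hpf] at h1
  have hpos : 0 < ∏ p ∈ d.primeFactors, p :=
    Finset.prod_pos fun p hp => (Nat.prime_of_mem_primeFactors hp).pos
  refine Nat.eq_of_mul_eq_mul_right hpos ?_
  rw [h1, mul_assoc v, h2]
  ring

/-! ### The sum over `u ∣ d` -/

/-- For multiplicative `f`, the sum of `μ f` over the divisors of `d` is a product over the primes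
dividing `d`. -/
theorem sum_divisors_moebius_mul {f : ArithmeticFunction ℝ} (hf : f.IsMultiplicative) {d : ℕ}
    (hd : d ≠ 0) :
    ∑ u ∈ d.divisors, (ArithmeticFunction.moebius u : ℝ) * f u =
      ∏ p ∈ d.primeFactors, (1 - f p) := by
  set g : ArithmeticFunction ℝ :=
    ((ArithmeticFunction.moebius : ArithmeticFunction ℝ).pmul f) * ArithmeticFunction.zeta with hg
  have hgm : g.IsMultiplicative :=
    ((ArithmeticFunction.isMultiplicative_moebius.intCast).pmul hf).mul
      ArithmeticFunction.isMultiplicative_zeta.natCast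
  have happ : ∀ n, g n = ∑ u ∈ n.divisors, (ArithmeticFunction.moebius u : ℝ) * f u := by
    intro n
    rw [hg, ArithmeticFunction.coe_mul_zeta_apply]
    simp [ArithmeticFunction.pmul_apply]
  rw [← happ, hgm.multiplicative_factorization _ hd, Nat.prod_factorization_eq_prod_primeFactors]
  refine Finset.prod_congr rfl fun p hp => ?_
  have hpp := Nat.prime_of_mem_primeFactors hp
  have hk : 1 ≤ d.factorization p :=
    (hpp.dvd_iff_one_le_factorization hd).1 (Nat.dvd_of_mem_primeFactors hp)
  obtain ⟨k, hk⟩ := Nat.exists_eq_add_of_le hk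
  rw [happ, Nat.sum_divisors_prime_pow hpp, hk, add_comm 1 k, Finset.sum_range_succ',
    Finset.sum_range_succ']
  have h0 : ∑ i ∈ Finset.range k,
      (ArithmeticFunction.moebius (p ^ (i + 1 + 1)) : ℝ) * f (p ^ (i + 1 + 1)) = 0 := by
    refine Finset.sum_eq_zero fun i _ => ?_
    rw [ArithmeticFunction.moebius_apply_prime_pow hpp (by omega)]
    simp
  rw [h0]
  simp [ArithmeticFunction.moebius_apply_prime hpp, hf.1]
  ring

/-- The function `m ↦ (m v, h) / (v, h)` is multiplicative. -/
theorem gcd_mul_mul_gcd_of_coprime {m n v h : ℕ} (hmn : m.Coprime n) (hm : m ≠ 0) (hn : n ≠ 0)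
    (hv : v ≠ 0) (hh : h ≠ 0) :
    Nat.gcd (m * n * v) h * Nat.gcd v h = Nat.gcd (m * v) h * Nat.gcd (n * v) h := by
  have hg : ∀ x, Nat.gcd x h ≠ 0 := fun x => Nat.gcd_ne_zero_right hh
  refine Nat.eq_of_factorization_eq (mul_ne_zero (hg _) (hg _)) (mul_ne_zero (hg _) (hg _)) ?_
  intro p
  have h0 : m.factorization p = 0 ∨ n.factorization p = 0 := by
    by_contra! hcon
    have h1 := Nat.dvd_of_factorization_pos hcon.1
    have h2 := Nat.dvd_of_factorization_pos hcon.2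
    have hp : p.Prime := by
      by_contra hp
      exact hcon.1 (Nat.factorization_eq_zero_of_not_prime _ hp)
    exact Nat.not_coprime_of_dvd_of_dvd hp.one_lt h1 h2 hmn
  rw [Nat.factorization_mul (hg _) (hg _), Nat.factorization_mul (hg _) (hg _),
    Nat.factorization_gcd (by positivity) hh, Nat.factorization_gcd (by positivity) hh,
    Nat.factorization_gcd (by positivity) hh, Nat.factorization_gcd (by positivity) hh,
    Nat.factorization_mul (by positivity) hv, Nat.factorization_mul hm hn,
    Nat.factorization_mul hm hv, Nat.factorization_mul hn hv]
  simp only [Finsupp.add_apply, Finsupp.inf_apply]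
  rcases h0 with h0 | h0 <;> rw [h0] <;> simp [add_comm]

theorem gcd_prime_mul {p v h : ℕ} (hp : p.Prime) (hv : v ≠ 0) (hh : h ≠ 0) :
    Nat.gcd (p * v) h =
      if h.factorization p ≤ v.factorization p then Nat.gcd v h else p * Nat.gcd v h := by
  have hg : ∀ x, Nat.gcd x h ≠ 0 := fun x => Nat.gcd_ne_zero_right hh
  have hpv : p * v ≠ 0 := mul_ne_zero hp.ne_zero hv
  split_ifs with hle
  · refine Nat.eq_of_factorization_eq (hg _) (hg _) fun r => ?_
    rw [Nat.factorization_gcd hpv hh, Nat.factorization_gcd hv hh,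
      Nat.factorization_mul hp.ne_zero hv]
    simp only [Finsupp.add_apply, Finsupp.inf_apply, hp.factorization, Finsupp.single_apply]
    split_ifs with hr
    · subst hr; omega
    · simp
  · refine Nat.eq_of_factorization_eq (hg _) (mul_ne_zero hp.ne_zero (hg _)) fun r => ?_
    rw [Nat.factorization_mul hp.ne_zero (hg _), Nat.factorization_gcd hpv hh,
      Nat.factorization_gcd hv hh, Nat.factorization_mul hp.ne_zero hv]
    simp only [Finsupp.add_apply, Finsupp.inf_apply, hp.factorization, Finsupp.single_apply]
    split_ifs with hr
    · subst hr; omega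
    · simp

theorem two_pow_dvd_mul_mul_iff {m n v k : ℕ} (hmn : m.Coprime n) :
    2 ^ k ∣ m * n * v ↔ 2 ^ k ∣ m * v ∨ 2 ^ k ∣ n * v := by
  constructor
  · intro hd
    by_cases h2 : 2 ∣ m
    · have : Nat.Coprime (2 ^ k) n :=
        Nat.Coprime.pow_left _ (Nat.Coprime.coprime_dvd_left h2 hmn)
      left
      rw [mul_comm m n, mul_assoc] at hd
      exact this.dvd_of_dvd_mul_left hd
    · have : Nat.Coprime (2 ^ k) m :=
        Nat.Coprime.pow_left _ ((Nat.prime_two.coprime_iff_not_dvd).2 h2)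
      right
      rw [mul_assoc] at hd
      exact this.dvd_of_dvd_mul_left hd
  · rintro (hd | hd)
    · exact hd.trans ⟨n, by ring⟩
    · exact hd.trans ⟨m, by ring⟩

open Classical in
/-- The function `u ↦ [q ∤ uv] (uv, h) / (u (v, h))`, which for a power `q` of two not dividing `v`
is multiplicative in `u`. -/
noncomputable def localWeight (q v h : ℕ) : ArithmeticFunction ℝ where
  toFun u := if u = 0 then 0 else
    if q ∣ u * v then 0 else (Nat.gcd (u * v) h : ℝ) / (u * Nat.gcd v h)
  map_zero' := by simp

theorem isMultiplicative_localWeight {k v h : ℕ} (hv : v ≠ 0) (hh : h ≠ 0) (hqv : ¬ 2 ^ k ∣ v) :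
    (localWeight (2 ^ k) v h).IsMultiplicative := by
  have hg : ∀ x, (Nat.gcd x h : ℝ) ≠ 0 := fun x => Nat.cast_ne_zero.2 (Nat.gcd_ne_zero_right hh)
  rw [ArithmeticFunction.IsMultiplicative.iff_ne_zero]
  constructor
  · simp [localWeight, hqv, hg]
  · intro m n hm hn hmn
    have hm' : (m : ℝ) ≠ 0 := Nat.cast_ne_zero.2 hm
    have hn' : (n : ℝ) ≠ 0 := Nat.cast_ne_zero.2 hn
    simp only [localWeight, ArithmeticFunction.coe_mk, hm, hn, mul_eq_zero, or_self, if_false,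
      two_pow_dvd_mul_mul_iff hmn]
    by_cases h1 : 2 ^ k ∣ m * v
    · simp [h1]
    by_cases h2 : 2 ^ k ∣ n * v
    · simp [h2]
    simp only [h1, h2, or_self, if_false]
    have key : (Nat.gcd (m * n * v) h : ℝ) * Nat.gcd v h =
        Nat.gcd (m * v) h * Nat.gcd (n * v) h := by
      exact_mod_cast gcd_mul_mul_gcd_of_coprime hmn hm hn hv hh
    have := hg v
    rw [div_mul_div_comm, div_eq_div_iff (by push_cast; positivity) (by positivity)]
    push_cast
    linear_combination (m * n * (Nat.gcd v h) : ℝ) * key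

theorem gcdInfty_dvd_iff {h d w : ℕ} (hw : w ≠ 0) :
    gcdInfty h d ∣ w ↔ ∀ p ∈ d.primeFactors, h.factorization p ≤ w.factorization p := by
  rw [← Nat.factorization_le_iff_dvd (gcdInfty_pos h d).ne' hw]
  constructor
  · intro H p hp
    have := H p
    rwa [factorization_gcdInfty, if_pos hp] at this
  · intro H p
    rw [factorization_gcdInfty]
    split_ifs with hp
    · exact H p hp
    · simp

theorem gcdInfty_two_dvd_iff {h w : ℕ} (hw : w ≠ 0) :
    gcdInfty h 2 ∣ w ↔ h.factorization 2 ≤ w.factorization 2 := by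
  rw [gcdInfty_dvd_iff hw]; simp [Nat.prime_two.primeFactors]

theorem factorization_two_mul {v : ℕ} (hv : v ≠ 0) (p : ℕ) :
    (2 * v).factorization p = (if p = 2 then 1 else 0) + v.factorization p := by
  rw [Nat.factorization_mul two_ne_zero hv, Finsupp.add_apply, Nat.prime_two.factorization,
    Finsupp.single_apply]
  simp [eq_comm]

/-- The local factors of the inner sum vanish unless `(h, d^∞)` divides `2v`. -/
theorem one_sub_localWeight_prime {h v p : ℕ} (hh : h ≠ 0) (hv : v ≠ 0)
    (hqv : ¬ gcdInfty h 2 ∣ v) (hp : p.Prime) :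
    1 - localWeight (gcdInfty h 2) v h p =
      if h.factorization p ≤ (2 * v).factorization p then (if p = 2 then 1 else 1 - (p : ℝ)⁻¹)
      else 0 := by
  have hg : (Nat.gcd v h : ℝ) ≠ 0 := Nat.cast_ne_zero.2 (Nat.gcd_ne_zero_right hh)
  have hp0 : (p : ℝ) ≠ 0 := Nat.cast_ne_zero.2 hp.ne_zero
  have hpv : p * v ≠ 0 := mul_ne_zero hp.ne_zero hv
  simp only [localWeight, ArithmeticFunction.coe_mk, hp.ne_zero, if_false]
  rw [gcd_prime_mul hp hv hh]
  by_cases h2 : p = 2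
  · subst h2
    rw [gcdInfty_two_dvd_iff hv] at hqv
    simp only [gcdInfty_two_dvd_iff hpv]
    rw [if_neg hqv]
    split_ifs
    · simp
    · push_cast; field_simp; ring
  · have h3 : ¬ gcdInfty h 2 ∣ p * v := by
      rw [gcdInfty_two_dvd_iff hpv, Nat.factorization_mul hp.ne_zero hv, Finsupp.add_apply,
        hp.factorization, Finsupp.single_apply, if_neg h2, zero_add]
      rwa [gcdInfty_two_dvd_iff hv] at hqv
    rw [if_neg h3, factorization_two_mul hv, if_neg h2, zero_add, if_neg h2]
    split_ifs
    · field_simp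
    · push_cast; field_simp; ring

theorem prod_erase_two_one_sub_inv {d : ℕ} (hd : d ≠ 0) (hd2 : 2 ∣ d) :
    ∏ p ∈ d.primeFactors.erase 2, (1 - (p : ℝ)⁻¹) = 2 * d.totient / d := by
  have h1 : ((d.totient : ℚ) : ℝ) = ((d * ∏ p ∈ d.primeFactors, (1 - (p : ℚ)⁻¹) : ℚ) : ℝ) := by
    rw [Nat.totient_eq_mul_prod_factors]
  push_cast at h1
  have h2 : 2 ∈ d.primeFactors := Nat.mem_primeFactors.2 ⟨Nat.prime_two, hd2, hd⟩
  rw [← Finset.mul_prod_erase _ _ h2] at h1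
  have hd' : (d : ℝ) ≠ 0 := Nat.cast_ne_zero.2 hd
  rw [h1]
  push_cast
  field_simp
  ring

theorem two_mul_gcd_eq_gcdInfty {h d v : ℕ} (hh : h ≠ 0) (hd : d ≠ 0) (hd2 : 2 ∣ d)
    (hv : DvdInfty v d) (hqv : ¬ gcdInfty h 2 ∣ v) (hH : gcdInfty h d ∣ 2 * v) :
    2 * Nat.gcd v h = gcdInfty h d := by
  have hv0 := hv.1.ne'
  have hg : Nat.gcd v h ≠ 0 := Nat.gcd_ne_zero_right hh
  rw [gcdInfty_dvd_iff (by positivity)] at hH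
  rw [gcdInfty_two_dvd_iff hv0] at hqv
  refine Nat.eq_of_factorization_eq (by positivity) (gcdInfty_pos h d).ne' fun p => ?_
  rw [factorization_two_mul hg, Nat.factorization_gcd hv0 hh, factorization_gcdInfty,
    Finsupp.inf_apply]
  split_ifs with h2 hp hp
  · subst h2
    have := hH 2 hp
    rw [factorization_two_mul hv0, if_pos rfl] at this
    omega
  · subst h2
    exact absurd (Nat.mem_primeFactors.2 ⟨Nat.prime_two, hd2, hd⟩) hp
  · have := hH p hp
    rw [factorization_two_mul hv0, if_neg h2] at this
    omega
  · have : v.factorization p = 0 := by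
      by_contra hcon
      have hpp : p.Prime := by
        by_contra hpp
        exact hcon (Nat.factorization_eq_zero_of_not_prime _ hpp)
      exact hp (Nat.mem_primeFactors.2
        ⟨hpp, hv.2 p hpp (Nat.dvd_of_factorization_pos hcon), hd⟩)
    rw [this]; simp

open Classical in
/-- The inner sum of `δ⁻`: up to a factor independent of `u`, the reciprocal of the degree
`[K_{dv,uv} : ℚ]` is `(u v, h) / u`, and `σ_{u,v}` requires `h₂ ∤ u v`. -/
theorem sum_divisors_moebius_gcd {h d v : ℕ} (hh : h ≠ 0) (hd : d ≠ 0) (hd2 : 2 ∣ d)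
    (hv : DvdInfty v d) :
    ∑ u ∈ d.divisors, (ArithmeticFunction.moebius u : ℝ) *
        (if gcdInfty h 2 ∣ u * v then 0 else (Nat.gcd (u * v) h : ℝ) / u) =
      if gcdInfty h d ∣ 2 * v ∧ ¬ gcdInfty h 2 ∣ v then
        (gcdInfty h d : ℝ) * d.totient / d else 0 := by
  have hv0 := hv.1.ne'
  have hg : (Nat.gcd v h : ℝ) ≠ 0 := Nat.cast_ne_zero.2 (Nat.gcd_ne_zero_right hh)
  by_cases hqv : gcdInfty h 2 ∣ v
  · rw [if_neg (by tauto)]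
    refine Finset.sum_eq_zero fun u _ => ?_
    rw [if_pos (hqv.mul_left u), mul_zero]
  have hmult : (localWeight (gcdInfty h 2) v h).IsMultiplicative := by
    rw [gcdInfty_two] at hqv ⊢
    exact isMultiplicative_localWeight hv0 hh hqv
  have h1 : ∑ u ∈ d.divisors, (ArithmeticFunction.moebius u : ℝ) *
        (if gcdInfty h 2 ∣ u * v then 0 else (Nat.gcd (u * v) h : ℝ) / u) =
      Nat.gcd v h * ∑ u ∈ d.divisors, (ArithmeticFunction.moebius u : ℝ) *
        localWeight (gcdInfty h 2) v h u := by
    rw [Finset.mul_sum]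
    refine Finset.sum_congr rfl fun u hu => ?_
    have hu0 : u ≠ 0 := (Nat.pos_of_mem_divisors hu).ne'
    have hu0' : (u : ℝ) ≠ 0 := Nat.cast_ne_zero.2 hu0
    simp only [localWeight, ArithmeticFunction.coe_mk, hu0, if_false]
    split_ifs
    · simp
    · field_simp
  rw [h1, sum_divisors_moebius_mul hmult hd]
  have h2 : 2 ∈ d.primeFactors := Nat.mem_primeFactors.2 ⟨Nat.prime_two, hd2, hd⟩
  by_cases hH : gcdInfty h d ∣ 2 * v
  · rw [if_pos ⟨hH, hqv⟩, ← two_mul_gcd_eq_gcdInfty hh hd hd2 hv hqv hH]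
    rw [gcdInfty_dvd_iff (by positivity)] at hH
    have h3 : ∏ p ∈ d.primeFactors, (1 - localWeight (gcdInfty h 2) v h p) =
        ∏ p ∈ d.primeFactors.erase 2, (1 - (p : ℝ)⁻¹) := by
      rw [← Finset.mul_prod_erase _ _ h2]
      rw [one_sub_localWeight_prime hh hv0 hqv Nat.prime_two, if_pos (hH 2 h2), if_pos rfl, one_mul]
      refine Finset.prod_congr rfl fun p hp => ?_
      rw [one_sub_localWeight_prime hh hv0 hqv
        (Nat.prime_of_mem_primeFactors (Finset.mem_of_mem_erase hp)),
        if_pos (hH p (Finset.mem_of_mem_erase hp)), if_neg (Finset.ne_of_mem_erase hp)]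
    rw [h3, prod_erase_two_one_sub_inv hd hd2]
    push_cast
    ring
  · rw [if_neg (by tauto)]
    rw [gcdInfty_dvd_iff (by positivity)] at hH
    push Not at hH
    obtain ⟨p, hp, hlt⟩ := hH
    rw [Finset.prod_eq_zero hp, mul_zero]
    rw [one_sub_localWeight_prime hh hv0 hqv (Nat.prime_of_mem_primeFactors hp),
      if_neg (by omega)]

/-! ### The sum over `v ∣ d^∞` -/

/-- The Euler product of `∑ w⁻²` over the odd numbers `w ∣ d^∞`. -/
theorem hasSum_inv_sq_odd_dvdInfty {d : ℕ} (hd : d ≠ 0) :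
    HasSum (fun w : {w : ℕ // DvdInfty w d ∧ ¬ 2 ∣ w} => ((w : ℝ) ^ 2)⁻¹)
      (∏ p ∈ d.primeFactors.erase 2, ((p : ℝ) ^ 2 / ((p : ℝ) ^ 2 - 1))) := by
  let f : ℕ →* ℝ :=
    { toFun := fun n => ((n : ℝ) ^ 2)⁻¹
      map_one' := by simp
      map_mul' := fun m n => by push_cast; rw [mul_pow, mul_inv] }
  have hf : ∀ {p : ℕ}, p.Prime → ‖f p‖ < 1 := by
    intro p hp
    have : (1 : ℝ) < p := by exact_mod_cast hp.one_lt
    change ‖((p : ℝ) ^ 2)⁻¹‖ < 1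
    rw [Real.norm_of_nonneg (by positivity)]
    exact inv_lt_one_of_one_lt₀ (one_lt_pow₀ this two_ne_zero)
  have key := (EulerProduct.summable_and_hasSum_factoredNumbers_prod_filter_prime_geometric
    (f := f) hf (d.primeFactors.erase 2)).2
  have hprod : ∏ p ∈ d.primeFactors.erase 2 with p.Prime, (1 - f p)⁻¹ =
      ∏ p ∈ d.primeFactors.erase 2, ((p : ℝ) ^ 2 / ((p : ℝ) ^ 2 - 1)) := by
    rw [Finset.filter_true_of_mem fun p hp =>
      Nat.prime_of_mem_primeFactors (Finset.mem_of_mem_erase hp)]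
    refine Finset.prod_congr rfl fun p hp => ?_
    have hp' := Nat.prime_of_mem_primeFactors (Finset.mem_of_mem_erase hp)
    have h1 : (1 : ℝ) < p := by exact_mod_cast hp'.one_lt
    have h2 : (p : ℝ) ^ 2 - 1 ≠ 0 := by nlinarith
    have h3 : (p : ℝ) ≠ 0 := by positivity
    change (1 - ((p : ℝ) ^ 2)⁻¹)⁻¹ = _
    rw [← one_div, ← one_div]
    field_simp
  rw [hprod] at key
  have hset : ∀ w, (DvdInfty w d ∧ ¬ 2 ∣ w) ↔
      w ∈ Nat.factoredNumbers (d.primeFactors.erase 2) := by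
    intro w
    rw [dvdInfty_iff_mem_factoredNumbers hd, Nat.mem_factoredNumbers_iff_primeFactors_subset,
      Nat.mem_factoredNumbers_iff_primeFactors_subset, Finset.subset_erase, and_assoc]
    refine and_congr_right fun hw => and_congr_right fun _ => not_congr ?_
    simp [Nat.mem_primeFactors, Nat.prime_two, hw]
  exact (Equiv.subtypeEquivRight hset).hasSum_iff.2 key

theorem prod_erase_two_eq {d : ℕ} (hd : d ≠ 0) (hd2 : 2 ∣ d) :
    ∏ p ∈ d.primeFactors.erase 2, ((p : ℝ) ^ 2 / ((p : ℝ) ^ 2 - 1)) =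
      3 / 4 * ∏ p ∈ d.primeFactors, ((p : ℝ) ^ 2 / ((p : ℝ) ^ 2 - 1)) := by
  have h2 : 2 ∈ d.primeFactors := Nat.mem_primeFactors.2 ⟨Nat.prime_two, hd2, hd⟩
  rw [← Finset.mul_prod_erase _ _ h2, ← mul_assoc]
  norm_num

theorem hasSum_of_eq {ι : Type*} {f g : ι → ℝ} {x y : ℝ} (h : HasSum g y) (hf : ∀ i, f i = g i)
    (hx : x = y) : HasSum f x := by
  obtain rfl : f = g := funext hf
  rwa [hx]

open Classical in
/-- The numbers `v ∣ d^∞` with `L ∣ 2v` and `2 ^ k ∤ v`, where `2 ^ k` is the exact power of two in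
`L`, are the products of `L / 2` with an odd number. -/
theorem hasSum_inv_sq_dvd_two_mul {d L k : ℕ} (hd : d ≠ 0) (hd2 : 2 ∣ d) (hL : DvdInfty L d)
    (hk : L.factorization 2 = k) (hk1 : 1 ≤ k) :
    HasSum (fun v : {v : ℕ // DvdInfty v d} =>
        if L ∣ 2 * (v : ℕ) ∧ ¬ 2 ^ k ∣ (v : ℕ) then (((v : ℕ) : ℝ) ^ 2)⁻¹ else 0)
      (3 / (L : ℝ) ^ 2 * ∏ p ∈ d.primeFactors, ((p : ℝ) ^ 2 / ((p : ℝ) ^ 2 - 1))) := by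
  have hL0 := hL.1.ne'
  obtain ⟨N, rfl⟩ : 2 ∣ L := (Nat.prime_two.dvd_iff_one_le_factorization hL0).2 (by omega)
  have hN : N ≠ 0 := by rintro rfl; exact hL0 rfl
  have hNd : DvdInfty N d := dvdInfty_of_dvd hL (Dvd.intro_left _ rfl)
  have hNk : N.factorization 2 + 1 = k := by
    rw [factorization_two_mul hN, if_pos rfl] at hk; omega
  -- with `L = 2 N`, the sum runs over `v = N w` with `w` odd
  let g : {w : ℕ // DvdInfty w d ∧ ¬ 2 ∣ w} → {v : ℕ // DvdInfty v d} :=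
    fun w => ⟨N * w, hNd.mul w.2.1⟩
  have hg : Function.Injective g := by
    intro w₁ w₂ h
    have : N * (w₁ : ℕ) = N * w₂ := congrArg Subtype.val h
    exact Subtype.ext (Nat.eq_of_mul_eq_mul_left (Nat.pos_of_ne_zero hN) this)
  have hw : ∀ w : ℕ, w ≠ 0 → (2 ^ k ∣ N * w ↔ 2 ∣ w) := by
    intro w hw
    rw [Nat.prime_two.pow_dvd_iff_le_factorization (mul_ne_zero hN hw),
      Nat.prime_two.dvd_iff_one_le_factorization hw, Nat.factorization_mul hN hw,
      Finsupp.add_apply]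
    omega
  rw [← hg.hasSum_iff]
  · have h1 := (hasSum_inv_sq_odd_dvdInfty hd).mul_left (((N : ℝ) ^ 2)⁻¹)
    rw [prod_erase_two_eq hd hd2] at h1
    refine hasSum_of_eq h1 (fun w => ?_) ?_
    · have : 2 * N ∣ 2 * (N * (w : ℕ)) ∧ ¬ 2 ^ k ∣ N * (w : ℕ) :=
        ⟨⟨w, by ring⟩, by rw [hw _ w.2.1.1.ne']; exact w.2.2⟩
      simp only [Function.comp_apply, g, if_pos this]
      push_cast
      rw [mul_pow, mul_inv]
    · push_cast
      field_simp
      norm_num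
      ring
  · intro v hv
    rw [if_neg]
    rintro ⟨h1, h2⟩
    obtain ⟨w, hvw⟩ := Nat.dvd_of_mul_dvd_mul_left two_pos h1
    refine hv ⟨⟨w, dvdInfty_of_dvd v.2 (Dvd.intro_left _ hvw.symm), ?_⟩, Subtype.ext hvw.symm⟩
    have hw0 : w ≠ 0 := by
      rintro rfl
      exact v.2.1.ne' (by simpa using hvw)
    rwa [hvw, hw w hw0] at h2

theorem factorization_two_gcdInfty {h d : ℕ} (hd : d ≠ 0) (hd2 : 2 ∣ d) :
    (gcdInfty h d).factorization 2 = h.factorization 2 := by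
  rw [factorization_gcdInfty, if_pos (Nat.mem_primeFactors.2 ⟨Nat.prime_two, hd2, hd⟩)]

/-- Among the `v` with `H ∣ 2v` and `q ∤ v`, those divisible by `e` are described by the same
conditions with `lcm H e` in the place of `H`. -/
theorem dvd_two_mul_and_dvd_iff {h d e v : ℕ} (hd : d ≠ 0) (hd2 : 2 ∣ d) (he : e ≠ 0)
    (hv : DvdInfty v d) :
    ((gcdInfty h d ∣ 2 * v ∧ ¬ gcdInfty h 2 ∣ v) ∧ e ∣ v) ↔
      (DvdInfty e d ∧ ¬ gcdInfty h 2 ∣ e) ∧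
        (Nat.lcm (gcdInfty h d) e ∣ 2 * v ∧ ¬ gcdInfty h 2 ∣ v) := by
  have hv0 := hv.1.ne'
  constructor
  · rintro ⟨⟨h1, h2⟩, h3⟩
    exact ⟨⟨dvdInfty_of_dvd hv h3, fun h4 => h2 (h4.trans h3)⟩,
      Nat.lcm_dvd h1 (h3.mul_left 2), h2⟩
  · rintro ⟨⟨h1, h2⟩, h3, h4⟩
    have h5 : gcdInfty h d ∣ 2 * v := (Nat.dvd_lcm_left _ _).trans h3
    refine ⟨⟨h5, h4⟩, ?_⟩
    have h6 : e ∣ 2 * v := (Nat.dvd_lcm_right _ _).trans h3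
    rw [← Nat.factorization_le_iff_dvd he hv0]
    rw [← Nat.factorization_le_iff_dvd he (by positivity)] at h6
    intro p
    have h7 := h6 p
    rw [factorization_two_mul hv0] at h7
    split_ifs at h7 with hp
    · subst hp
      rw [gcdInfty_dvd_iff (by positivity)] at h5
      have h8 := h5 2 (Nat.mem_primeFactors.2 ⟨Nat.prime_two, hd2, hd⟩)
      rw [factorization_two_mul hv0, if_pos rfl] at h8
      rw [gcdInfty_two_dvd_iff he] at h2
      omega
    · omega

open Classical in
/-- The sum over `v`. The terms with `e ∣ v` are subtracted from the sum over all `v`; they form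
the same kind of sum, with `[(h, d^∞), e]` in the place of `(h, d^∞)`. -/
theorem hasSum_not_dvd_inv_sq {h d e : ℕ} (hh2 : 2 ∣ h) (hh : h ≠ 0) (hd : d ≠ 0) (hd2 : 2 ∣ d)
    (he : e ≠ 0) :
    HasSum (fun v : {v : ℕ // DvdInfty v d} =>
        if e ∣ (v : ℕ) then 0 else
          if gcdInfty h d ∣ 2 * (v : ℕ) ∧ ¬ gcdInfty h 2 ∣ (v : ℕ) then
            (gcdInfty h d : ℝ) / (2 * d * ((v : ℕ) : ℝ) ^ 2) else 0)
      (3 / (2 * (d : ℝ)) *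
        (1 / (gcdInfty h d : ℝ) -
          (if DvdInfty e d ∧ ¬ gcdInfty h 2 ∣ e then 1 else 0) *
            ((gcdInfty h d : ℝ) / (Nat.lcm (gcdInfty h d) e : ℝ) ^ 2)) *
        ∏ p ∈ d.primeFactors, ((p : ℝ) ^ 2 / ((p : ℝ) ^ 2 - 1))) := by
  have hq : gcdInfty h 2 = 2 ^ h.factorization 2 := by
    rw [gcdInfty_two, Nat.factorization_def _ Nat.prime_two]
  have hk1 : 1 ≤ h.factorization 2 := (Nat.prime_two.dvd_iff_one_le_factorization hh).1 hh2
  have hd0 : (d : ℝ) ≠ 0 := Nat.cast_ne_zero.2 hd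
  have hH0 : (gcdInfty h d : ℝ) ≠ 0 := Nat.cast_ne_zero.2 (gcdInfty_pos h d).ne'
  have hA := (hasSum_inv_sq_dvd_two_mul hd hd2 (dvdInfty_gcdInfty h)
    (factorization_two_gcdInfty hd hd2) hk1).mul_left ((gcdInfty h d : ℝ) / (2 * d))
  rw [← hq] at hA
  by_cases hE : DvdInfty e d ∧ ¬ gcdInfty h 2 ∣ e
  · have hL : DvdInfty (Nat.lcm (gcdInfty h d) e) d :=
      dvdInfty_of_dvd ((dvdInfty_gcdInfty h).mul hE.1) (Nat.lcm_dvd_mul _ _)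
    have hLk : (Nat.lcm (gcdInfty h d) e).factorization 2 = h.factorization 2 := by
      rw [Nat.factorization_lcm (gcdInfty_pos h d).ne' he, Finsupp.sup_apply,
        factorization_two_gcdInfty hd hd2]
      have := hE.2
      rw [gcdInfty_two_dvd_iff he] at this
      omega
    have hL0 : (Nat.lcm (gcdInfty h d) e : ℝ) ≠ 0 := Nat.cast_ne_zero.2 hL.1.ne'
    have hB := (hasSum_inv_sq_dvd_two_mul hd hd2 hL hLk hk1).mul_left
      ((gcdInfty h d : ℝ) / (2 * d))
    rw [← hq] at hB
    have hAB := hA.sub hB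
    refine hasSum_of_eq hAB (fun v => ?_) ?_
    · have hiff := dvd_two_mul_and_dvd_iff (h := h) hd hd2 he v.2
      have hv0 : ((v : ℕ) : ℝ) ≠ 0 := Nat.cast_ne_zero.2 v.2.1.ne'
      by_cases h1 : gcdInfty h d ∣ 2 * (v : ℕ) ∧ ¬ gcdInfty h 2 ∣ (v : ℕ)
      · by_cases h2 : e ∣ (v : ℕ)
        · rw [if_pos h2, if_pos h1, if_pos (hiff.1 ⟨h1, h2⟩).2, sub_self]
        · rw [if_neg h2, if_pos h1, if_pos h1, if_neg fun h3 => h2 (hiff.2 ⟨hE, h3⟩).2]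
          field_simp
          simp
      · rw [if_neg h1, if_neg h1, if_neg fun h3 => h1 (hiff.2 ⟨hE, h3⟩).1]
        simp
    · rw [if_pos hE]
      field_simp
  · refine hasSum_of_eq hA (fun v => ?_) ?_
    · have hiff := dvd_two_mul_and_dvd_iff (h := h) hd hd2 he v.2
      have hv0 : ((v : ℕ) : ℝ) ≠ 0 := Nat.cast_ne_zero.2 v.2.1.ne'
      by_cases h1 : gcdInfty h d ∣ 2 * (v : ℕ) ∧ ¬ gcdInfty h 2 ∣ (v : ℕ)
      · by_cases h2 : e ∣ (v : ℕ)
        · exact absurd (hiff.1 ⟨h1, h2⟩).1 hE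
        · rw [if_neg h2, if_pos h1, if_pos h1]
          field_simp
      · rw [if_neg h1, if_neg h1]
        simp
    · rw [if_neg hE]
      field_simp
      ring

/-! ### Cyclotomic fields in an algebraic closure -/

theorem pow_eq_pow_iff_modEq_of_isPrimitiveRoot {M : Type*} [CommMonoid M] {z : M} {n i j : ℕ}
    (hz : IsPrimitiveRoot z n) (hn : 0 < n) : z ^ i = z ^ j ↔ i ≡ j [MOD n] := by
  rw [(hz.isOfFinOrder hn.ne').pow_eq_pow_iff_modEq, ← hz.eq_orderOf]

section CyclotomicFields

variable {Ω : Type*} [Field Ω] [Algebra ℚ Ω]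

theorem mem_adjoin_of_pow_eq_one {z x : Ω} {n : ℕ} (hz : IsPrimitiveRoot z n) (hn : 0 < n)
    (hx : x ^ n = 1) : x ∈ ℚ⟮z⟯ := by
  have : NeZero n := ⟨hn.ne'⟩
  obtain ⟨i, -, rfl⟩ := hz.eq_pow_of_pow_eq_one hx
  exact pow_mem (IntermediateField.mem_adjoin_simple_self ℚ z) i

theorem adjoin_primitiveRoot_le {z w : Ω} {m n : ℕ} (hz : IsPrimitiveRoot z m)
    (hw : IsPrimitiveRoot w n) (hn : 0 < n) (hmn : m ∣ n) : ℚ⟮z⟯ ≤ ℚ⟮w⟯ := by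
  rw [IntermediateField.adjoin_simple_le_iff]
  obtain ⟨c, rfl⟩ := hmn
  exact mem_adjoin_of_pow_eq_one hw hn (by rw [pow_mul, hz.pow_eq_one, one_pow])

variable [IsAlgClosure ℚ Ω]

/-- The Galois correspondence for `Ω / ℚ`, with the subfield given by generators. -/
theorem mem_adjoin_iff_forall_algEquiv {S : Set Ω} {x : Ω} :
    x ∈ IntermediateField.adjoin ℚ S ↔
      ∀ τ : Ω ≃ₐ[ℚ] Ω, (∀ s ∈ S, τ s = s) → τ x = x := by
  conv_lhs => rw [← InfiniteGalois.fixedField_fixingSubgroup (IntermediateField.adjoin ℚ S)]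
  rw [IntermediateField.mem_fixedField_iff]
  refine forall_congr' fun τ => imp_congr_left ?_
  rw [IntermediateField.mem_fixingSubgroup_iff]
  constructor
  · exact fun h s hs => h s (IntermediateField.subset_adjoin _ _ hs)
  · intro h y hy
    induction hy using IntermediateField.adjoin_induction with
    | mem y hy => exact h y hy
    | algebraMap q => exact τ.commutes q
    | add y z _ _ hy hz => rw [map_add, hy, hz]
    | inv y _ hy => rw [map_inv₀, hy]
    | mul y z _ _ hy hz => rw [map_mul, hy, hz]

theorem mem_adjoin_simple_iff_forall_algEquiv {z x : Ω} :
    x ∈ ℚ⟮z⟯ ↔ ∀ τ : Ω ≃ₐ[ℚ] Ω, τ z = z → τ x = x := by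
  rw [mem_adjoin_iff_forall_algEquiv]; simp

theorem algEquiv_eq_of_mem_adjoin {S : Set Ω} {x : Ω} (hx : x ∈ IntermediateField.adjoin ℚ S)
    {σ τ : Ω ≃ₐ[ℚ] Ω} (h : ∀ s ∈ S, σ s = τ s) : σ x = τ x := by
  have := mem_adjoin_iff_forall_algEquiv.1 hx (τ⁻¹ * σ) fun s hs => by
    rw [AlgEquiv.mul_apply, h s hs]; exact τ.symm_apply_apply s
  rw [AlgEquiv.mul_apply] at this
  exact (τ.apply_symm_apply (σ x)).symm.trans (congrArg τ this)

theorem exists_isPrimitiveRoot {n : ℕ} (hn : 0 < n) : ∃ z : Ω, IsPrimitiveRoot z n := by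
  have := IsAlgClosure.isAlgClosed ℚ (K := Ω)
  have := charZero_of_injective_algebraMap (algebraMap ℚ Ω).injective
  have : NeZero (n : Ω) := ⟨Nat.cast_ne_zero.2 hn.ne'⟩
  have : NeZero n := ⟨hn.ne'⟩
  exact HasEnoughRootsOfUnity.exists_primitiveRoot Ω n

/-- Irreducibility of the cyclotomic polynomials, as the existence of automorphisms. -/
theorem exists_algEquiv_pow {z : Ω} {n k : ℕ} (hz : IsPrimitiveRoot z n) (hn : 0 < n)
    (hk : k.Coprime n) : ∃ τ : Ω ≃ₐ[ℚ] Ω, τ z = z ^ k := by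
  have := charZero_of_injective_algebraMap (algebraMap ℚ Ω).injective
  have h : IsConjRoot ℚ (z ^ k) z := by
    have h1 := Polynomial.cyclotomic_eq_minpoly_rat hz hn
    have h2 := Polynomial.cyclotomic_eq_minpoly_rat (hz.pow_of_coprime k hk) hn
    rw [isConjRoot_def]
    convert h2.symm.trans h1 using 2 <;> exact Subsingleton.elim _ _
  exact h.exists_algEquiv

/-- The intersection of two cyclotomic fields: `ℚ(ζ_m) ∩ ℚ(ζ_n) ⊆ ℚ(ζ_{(m,n)})`. -/
theorem mem_adjoin_gcd {z w u x : Ω} {m n : ℕ} (hm : 0 < m) (hn : 0 < n)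
    (hz : IsPrimitiveRoot z m) (hw : IsPrimitiveRoot w n) (hu : IsPrimitiveRoot u (Nat.gcd m n))
    (hxz : x ∈ ℚ⟮z⟯) (hxw : x ∈ ℚ⟮w⟯) : x ∈ ℚ⟮u⟯ := by
  have hg : 0 < Nat.gcd m n := Nat.gcd_pos_of_pos_left n hm
  rw [mem_adjoin_simple_iff_forall_algEquiv]
  intro σ hσ
  have : NeZero n := ⟨hn.ne'⟩
  have : NeZero (Nat.gcd m n) := ⟨hg.ne'⟩
  have hσw : IsPrimitiveRoot (σ w) n := hw.map_of_injective σ.injective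
  obtain ⟨j, -, hj⟩ := hw.eq_pow_of_pow_eq_one hσw.pow_eq_one
  have hjn : j.Coprime n := by
    rw [← hj] at hσw
    exact (hw.pow_iff_coprime hn j).1 hσw
  -- `σ` fixes the roots of unity of order `(m, n)`, so that `j ≡ 1` modulo `(m, n)`
  have hj1 : 1 ≡ j [MOD Nat.gcd m n] := by
    obtain ⟨c, hc⟩ := Nat.gcd_dvd_right m n
    have hwc : IsPrimitiveRoot (w ^ c) (Nat.gcd m n) := hw.pow hn (by rw [mul_comm]; exact hc)
    have hfix : σ (w ^ c) = w ^ c :=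
      mem_adjoin_simple_iff_forall_algEquiv.1
        (mem_adjoin_of_pow_eq_one hu hg hwc.pow_eq_one) σ hσ
    rw [map_pow, ← hj, ← pow_mul, mul_comm, pow_mul] at hfix
    have h1 : (w ^ c) ^ 1 = (w ^ c) ^ j := by rw [hfix, pow_one]
    rwa [pow_eq_pow_iff_modEq_of_isPrimitiveRoot hwc hg] at h1
  -- an automorphism that fixes `ζ_m` and agrees with `σ` on `ζ_n`
  obtain ⟨k, hk1, hk2⟩ := Nat.chineseRemainder' hj1
  have hkm : k.Coprime m := by
    have := hk1.gcd_eq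
    rwa [Nat.gcd_one_left] at this
  have hkn : k.Coprime n := by
    have := hk2.gcd_eq
    rwa [hjn] at this
  have hl : 0 < Nat.lcm m n := Nat.lcm_pos hm hn
  obtain ⟨v, hv⟩ := exists_isPrimitiveRoot (Ω := Ω) hl
  have : NeZero (Nat.lcm m n) := ⟨hl.ne'⟩
  obtain ⟨τ, hτ⟩ := exists_algEquiv_pow hv hl
    (Nat.Coprime.coprime_dvd_right (Nat.lcm_dvd_mul m n) (hkm.mul_right hkn))
  have hτpow : ∀ y : Ω, y ^ Nat.lcm m n = 1 → τ y = y ^ k := by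
    intro y hy
    obtain ⟨i, -, rfl⟩ := hv.eq_pow_of_pow_eq_one hy
    rw [map_pow, hτ, ← pow_mul, ← pow_mul, mul_comm]
  have hτz : τ z = z := by
    rw [hτpow z ((hz.pow_eq_one_iff_dvd _).2 (Nat.dvd_lcm_left m n))]
    conv_rhs => rw [← pow_one z]
    rw [pow_eq_pow_iff_modEq_of_isPrimitiveRoot hz hm]
    exact hk1
  have hτw : ∀ s ∈ ({w} : Set Ω), τ s = σ s := by
    rintro s rfl
    rw [hτpow s ((hw.pow_eq_one_iff_dvd _).2 (Nat.dvd_lcm_right m n)), ← hj,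
      pow_eq_pow_iff_modEq_of_isPrimitiveRoot hw hn]
    exact hk2
  rw [← algEquiv_eq_of_mem_adjoin hxw hτw]
  exact mem_adjoin_simple_iff_forall_algEquiv.1 hxz τ hτz

end CyclotomicFields

/-! ### Square roots in cyclotomic fields -/

theorem isPrimitiveRoot_eight_pow_four {F : Type*} [Field F] {z : F}
    (hz : IsPrimitiveRoot z 8) : z ^ 4 = -1 := by
  have h : (z ^ 4) ^ 2 = 1 := by rw [← pow_mul]; exact hz.pow_eq_one
  refine (sq_eq_sq_iff_eq_or_eq_neg.1 (h.trans (one_pow 2).symm)).resolve_left ?_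
  exact hz.pow_ne_one_of_pos_of_lt (by norm_num) (by norm_num)

theorem isPrimitiveRoot_four_sq {F : Type*} [Field F] {z : F} (hz : IsPrimitiveRoot z 4) :
    z ^ 2 = -1 := by
  have h : (z ^ 2) ^ 2 = 1 := by rw [← pow_mul]; exact hz.pow_eq_one
  refine (sq_eq_sq_iff_eq_or_eq_neg.1 (h.trans (one_pow 2).symm)).resolve_left ?_
  exact hz.pow_ne_one_of_pos_of_lt (by norm_num) (by norm_num)

theorem add_inv_sq_of_isPrimitiveRoot_eight {F : Type*} [Field F] {z : F}
    (hz : IsPrimitiveRoot z 8) : (z + z⁻¹) ^ 2 = 2 := by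
  have h4 := isPrimitiveRoot_eight_pow_four hz
  have h0 : z ≠ 0 := hz.ne_zero (by norm_num)
  field_simp
  linear_combination h4

theorem sub_inv_sq_of_isPrimitiveRoot_eight {F : Type*} [Field F] {z : F}
    (hz : IsPrimitiveRoot z 8) : (z - z⁻¹) ^ 2 = -2 := by
  have h4 := isPrimitiveRoot_eight_pow_four hz
  have h0 : z ≠ 0 := hz.ne_zero (by norm_num)
  field_simp
  linear_combination h4

theorem χ₄_eq_one_or_neg_one {D : ℕ} (hD : Odd D) : ZMod.χ₄ D = 1 ∨ ZMod.χ₄ D = -1 := by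
  rcases Nat.odd_mod_four_iff.1 (Nat.odd_iff.1 hD) with h | h
  · exact Or.inl (ZMod.χ₄_nat_one_mod_four h)
  · exact Or.inr (ZMod.χ₄_nat_three_mod_four h)

section QuadraticSubfields

variable {Ω : Type*} [Field Ω] [Algebra ℚ Ω]

/-- The quadratic Gauss sum: a square root of `p* = (-1)^((p-1)/2) p` in `ℚ(ζ_p)`. -/
theorem exists_sq_eq_prime_mem_adjoin {p : ℕ} (hp : p.Prime) (hp2 : Odd p) {z : Ω}
    (hz : IsPrimitiveRoot z p) :
    ∃ g ∈ ℚ⟮z⟯, g ^ 2 = ((ZMod.χ₄ p : ℤ) : Ω) * p := by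
  have := charZero_of_injective_algebraMap (algebraMap ℚ Ω).injective
  have : Fact p.Prime := ⟨hp⟩
  have hchar : ringChar (ZMod p) ≠ 2 := by
    rw [ZMod.ringChar_zmod_n]
    rintro rfl
    exact absurd hp2 (by decide)
  let χ : MulChar (ZMod p) Ω := (quadraticChar (ZMod p)).ringHomComp (Int.castRingHom Ω)
  let ψ : AddChar (ZMod p) Ω := AddChar.zmodChar p hz.pow_eq_one
  refine ⟨gaussSum χ ψ, ?_, ?_⟩
  · refine sum_mem fun a _ => mul_mem ?_ ?_
    · exact intCast_mem _ _
    · rw [AddChar.zmodChar_apply]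
      exact pow_mem (IntermediateField.mem_adjoin_simple_self ℚ z) _
  · have hχ1 : χ ≠ 1 :=
      (MulChar.ringHomComp_ne_one_iff (RingHom.injective_int _)).2 (quadraticChar_ne_one hchar)
    have hχ2 : χ.IsQuadratic := (quadraticChar_isQuadratic (ZMod p)).comp _
    rw [gaussSum_sq hχ1 hχ2 (AddChar.zmodChar_primitive_of_primitive_root p hz)]
    have h1 : χ (-1) = ((quadraticChar (ZMod p) (-1) : ℤ) : Ω) := rfl
    rw [h1, quadraticChar_neg_one hchar, ZMod.card]

theorem mem_of_sq_eq_sq {K : IntermediateField ℚ Ω} {x y : Ω} (hy : y ∈ K)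
    (hxy : x ^ 2 = y ^ 2) : x ∈ K := by
  rcases sq_eq_sq_iff_eq_or_eq_neg.1 hxy with rfl | rfl
  · exact hy
  · exact neg_mem hy

/-- A product of Gauss sums: for odd `D`, one of `√D`, `√(-D)` lies in `ℚ(ζ_D)`. -/
theorem exists_sq_eq_odd_mem_adjoin {D : ℕ} (hD : Odd D) {z : Ω}
    (hz : IsPrimitiveRoot z D) : ∃ g ∈ ℚ⟮z⟯, g ^ 2 = ((ZMod.χ₄ D : ℤ) : Ω) * D := by
  induction D using induction_on_primes generalizing z with
  | zero => exact absurd hD (by decide)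
  | one => exact ⟨1, one_mem _, by simp⟩
  | prime_mul p a hp ih =>
    have hpa := Nat.odd_mul.1 hD
    have hpos : 0 < p * a := hD.pos
    obtain ⟨g₁, hg₁, h1⟩ := exists_sq_eq_prime_mem_adjoin hp hpa.1
      (hz.pow hpos (mul_comm p a))
    obtain ⟨g₂, hg₂, h2⟩ := ih hpa.2 (hz.pow hpos rfl)
    have hle : ∀ k, ℚ⟮z ^ k⟯ ≤ ℚ⟮z⟯ := fun k =>
      IntermediateField.adjoin_simple_le_iff.2
        (pow_mem (IntermediateField.mem_adjoin_simple_self ℚ z) k)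
    refine ⟨g₁ * g₂, mul_mem (hle _ hg₁) (hle _ hg₂), ?_⟩
    rw [mul_pow, h1, h2]
    push_cast
    rw [map_mul]
    push_cast
    ring

/-- The discriminant of `ℚ(√D)`, for a squarefree `D > 1`. -/
def quadraticDiscr (D : ℕ) : ℕ := if D % 4 = 1 then D else 4 * D

/-- The field `ℚ(√D)` lies in the cyclotomic field of its discriminant: `√D` is the product of a
Gauss sum for the odd part of `D` with one of `1`, `√-1`, `√2` and `√-2`. -/
theorem mem_adjoin_quadraticDiscr {D : ℕ} (hD : Squarefree D) {r z : Ω} (hr : r ^ 2 = D)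
    (hz : IsPrimitiveRoot z (quadraticDiscr D)) : r ∈ ℚ⟮z⟯ := by
  have hle : ∀ k, ℚ⟮z ^ k⟯ ≤ ℚ⟮z⟯ := fun k =>
    IntermediateField.adjoin_simple_le_iff.2
      (pow_mem (IntermediateField.mem_adjoin_simple_self ℚ z) k)
  have hD0 : 0 < D := Nat.pos_of_ne_zero hD.ne_zero
  rcases Nat.even_or_odd D with hev | hodd
  · obtain ⟨E, rfl⟩ := hev.two_dvd
    have hE : Odd E := by
      rw [← Nat.not_even_iff_odd, even_iff_two_dvd]
      intro h2
      exact absurd (Nat.isUnit_iff.1 (hD 2 (Nat.mul_dvd_mul_left 2 h2))) (by norm_num)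
    have hz8 : IsPrimitiveRoot z (8 * E) := by
      have : quadraticDiscr (2 * E) = 8 * E := by
        rw [quadraticDiscr, if_neg (by omega)]; ring
      rwa [this] at hz
    have hpos : 0 < 8 * E := by omega
    obtain ⟨g, hg, hg2⟩ := exists_sq_eq_odd_mem_adjoin hE (hz8.pow hpos rfl)
    have h8 : IsPrimitiveRoot (z ^ E) 8 := hz8.pow hpos (mul_comm _ _)
    have hy := IntermediateField.mem_adjoin_simple_self ℚ (z ^ E)
    rcases χ₄_eq_one_or_neg_one hE with h | h
    · refine mem_of_sq_eq_sq (mul_mem (hle _ hg) (hle _ (add_mem hy (inv_mem hy)))) ?_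
      rw [hr, mul_pow, hg2, add_inv_sq_of_isPrimitiveRoot_eight h8, h]
      push_cast; ring
    · refine mem_of_sq_eq_sq (mul_mem (hle _ hg) (hle _ (sub_mem hy (inv_mem hy)))) ?_
      rw [hr, mul_pow, hg2, sub_inv_sq_of_isPrimitiveRoot_eight h8, h]
      push_cast; ring
  · rcases Nat.odd_mod_four_iff.1 (Nat.odd_iff.1 hodd) with h | h
    · rw [quadraticDiscr, if_pos h] at hz
      obtain ⟨g, hg, hg2⟩ := exists_sq_eq_odd_mem_adjoin hodd hz
      refine mem_of_sq_eq_sq hg ?_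
      rw [hr, hg2, ZMod.χ₄_nat_one_mod_four h]
      push_cast; ring
    · rw [quadraticDiscr, if_neg (by omega)] at hz
      have hpos : 0 < 4 * D := by omega
      obtain ⟨g, hg, hg2⟩ := exists_sq_eq_odd_mem_adjoin hodd (hz.pow hpos rfl)
      have h4 : IsPrimitiveRoot (z ^ D) 4 := hz.pow hpos (mul_comm _ _)
      refine mem_of_sq_eq_sq (mul_mem (hle _ hg)
        (hle _ (IntermediateField.mem_adjoin_simple_self ℚ (z ^ D)))) ?_
      rw [hr, mul_pow, hg2, isPrimitiveRoot_four_sq h4, ZMod.χ₄_nat_three_mod_four h]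
      push_cast; ring

theorem sq_ne_intCast_of_mem_bot {x : Ω} (hx : x ∈ (⊥ : IntermediateField ℚ Ω)) {m : ℤ}
    (hm : ∀ q : ℚ, q ^ 2 ≠ m) : x ^ 2 ≠ m := by
  have := charZero_of_injective_algebraMap (algebraMap ℚ Ω).injective
  obtain ⟨q, rfl⟩ := IntermediateField.mem_bot.1 hx
  intro h
  apply hm q
  apply (algebraMap ℚ Ω).injective
  rw [map_pow, h, map_intCast]

theorem rat_sq_ne_prime {p : ℕ} (hp : p.Prime) (q : ℚ) : q ^ 2 ≠ p := by
  intro h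
  have h1 : IsSquare (p : ℚ) := ⟨q, by rw [← h, sq]⟩
  rw [Rat.isSquare_natCast_iff] at h1
  exact hp.prime.irreducible.not_isSquare h1

theorem adjoin_primitiveRoot_eq_bot {z : Ω} {n : ℕ} (hz : IsPrimitiveRoot z n) (hn : n ∣ 2) :
    ℚ⟮z⟯ = ⊥ := by
  rw [IntermediateField.adjoin_simple_eq_bot_iff]
  have h : z ^ 2 = 1 := (hz.pow_eq_one_iff_dvd 2).2 hn
  rcases sq_eq_sq_iff_eq_or_eq_neg.1 (h.trans (one_pow 2).symm) with rfl | rfl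
  · exact one_mem _
  · exact neg_mem (one_mem _)

end QuadraticSubfields

/-! ### The conductor of a real quadratic field -/

section Conductor

variable {Ω : Type*} [Field Ω] [Algebra ℚ Ω]

/-- If `g` and `r` lie in fields generated by roots of unity of orders `m` and `n`, then `r / g`
lies in the field generated by a primitive root of unity of order `mn`. -/
theorem div_mem_adjoin_mul {g r z w v : Ω} {m n : ℕ} (hm : 0 < m) (hn : 0 < n)
    (hz : IsPrimitiveRoot z m) (hw : IsPrimitiveRoot w n) (hv : IsPrimitiveRoot v (m * n))
    (hr : r ∈ ℚ⟮z⟯) (hg : g ∈ ℚ⟮w⟯) : r / g ∈ ℚ⟮v⟯ :=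
  div_mem (adjoin_primitiveRoot_le hz hv (Nat.mul_pos hm hn) (Dvd.intro _ rfl) hr)
    (adjoin_primitiveRoot_le hw hv (Nat.mul_pos hm hn) (Dvd.intro_left _ rfl) hg)

variable [IsAlgClosure ℚ Ω]

/-- If `√D ∈ ℚ(ζ_n)`, then every odd prime divisor of the squarefree number `D` divides `n`:
otherwise the square root of `p* = ±p` would lie in `ℚ(ζ_p) ∩ ℚ(ζ_{8nD/p}) = ℚ`. -/
theorem odd_prime_dvd_of_sqrt_mem_adjoin {D n p : ℕ} (hD : Squarefree D) (hn : 0 < n) {r z : Ω}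
    (hr : r ^ 2 = D) (hz : IsPrimitiveRoot z n) (hrz : r ∈ ℚ⟮z⟯) (hp : p.Prime) (hp2 : p ≠ 2)
    (hpD : p ∣ D) : p ∣ n := by
  have := charZero_of_injective_algebraMap (algebraMap ℚ Ω).injective
  have hodd : Odd p := hp.odd_of_ne_two hp2
  obtain ⟨E, rfl⟩ := hpD
  have hpE : ¬ p ∣ E := fun h =>
    hp.one_lt.ne' (Nat.isUnit_iff.1 (hD p (Nat.mul_dvd_mul_left p h)))
  have hE : Squarefree E := hD.squarefree_of_dvd (Dvd.intro_left _ rfl)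
  have hE0 : 0 < E := Nat.pos_of_ne_zero hE.ne_zero
  by_contra hpn
  obtain ⟨w, hw⟩ := exists_isPrimitiveRoot (Ω := Ω) hp.pos
  obtain ⟨g, hg, hg2⟩ := exists_sq_eq_prime_mem_adjoin hp hodd hw
  have hp0 : (p : Ω) ≠ 0 := Nat.cast_ne_zero.2 hp.ne_zero
  -- a square root of `±E` lies in `ℚ(ζ_{8E})`, which also contains `√-1`
  obtain ⟨y, hy⟩ := exists_isPrimitiveRoot (Ω := Ω) (n := 8 * E) (by omega)
  have hEy : ∀ t : Ω, t ^ 2 = E → t ∈ ℚ⟮y⟯ := by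
    intro t ht
    have hqd : quadraticDiscr E ∣ 8 * E := by
      rw [quadraticDiscr]
      split_ifs
      · exact Dvd.intro_left _ rfl
      · exact ⟨2, by ring⟩
    obtain ⟨c, hc⟩ := hqd
    have h1 := hy.pow (by omega : 0 < 8 * E) (show 8 * E = c * quadraticDiscr E by rw [hc]; ring)
    exact IntermediateField.adjoin_simple_le_iff.2
      (pow_mem (IntermediateField.mem_adjoin_simple_self ℚ y) c)
      (mem_adjoin_quadraticDiscr hE ht h1)
  have hχ := χ₄_eq_one_or_neg_one hodd
  have hg0 : g ≠ 0 := by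
    rintro rfl
    rcases hχ with h | h <;> rw [h] at hg2 <;> exact hp0 (by simpa using hg2.symm)
  have hrg : r / g ∈ ℚ⟮y⟯ := by
    rcases hχ with h | h
    · refine hEy _ ?_
      rw [div_pow, hr, hg2, h]
      push_cast
      field_simp
    · have h4 : IsPrimitiveRoot (y ^ (2 * E)) 4 :=
        hy.pow (by omega : 0 < 8 * E) (by ring)
      have hi := isPrimitiveRoot_four_sq h4
      have hi0 : y ^ (2 * E) ≠ 0 := h4.ne_zero (by norm_num)
      have hm : r / g * y ^ (2 * E) ∈ ℚ⟮y⟯ := by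
        refine hEy _ ?_
        rw [mul_pow, hi, div_pow, hr, hg2, h]
        push_cast
        field_simp
      have := div_mem hm (pow_mem (IntermediateField.mem_adjoin_simple_self ℚ y) (2 * E))
      rwa [mul_div_cancel_right₀ _ hi0] at this
  have hr0 : r ≠ 0 := by
    rintro rfl
    have : ((p * E : ℕ) : Ω) ≠ 0 := Nat.cast_ne_zero.2 (mul_ne_zero hp.ne_zero hE0.ne')
    exact this (by rw [← hr]; simp)
  obtain ⟨v, hv⟩ := exists_isPrimitiveRoot (Ω := Ω) (n := n * (8 * E))
    (Nat.mul_pos hn (by omega))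
  have hgv : g ∈ ℚ⟮v⟯ := by
    have := div_mem_adjoin_mul hn (by omega : 0 < 8 * E) hz hy hv hrz hrg
    rwa [div_div_cancel₀ hr0] at this
  have hcop : Nat.gcd (n * (8 * E)) p = 1 := by
    rw [← Nat.coprime_iff_gcd_eq_one, Nat.coprime_comm, hp.coprime_iff_not_dvd]
    intro h
    rcases hp.dvd_mul.1 h with h | h
    · exact hpn h
    rcases hp.dvd_mul.1 h with h | h
    · exact hp2 ((Nat.prime_dvd_prime_iff_eq hp Nat.prime_two).1
        (hp.dvd_of_dvd_pow (show p ∣ 2 ^ 3 from h)))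
    · exact hpE h
  have h1 : IsPrimitiveRoot (1 : Ω) (Nat.gcd (n * (8 * E)) p) := by
    rw [hcop]; exact IsPrimitiveRoot.one
  have hbot := mem_adjoin_gcd (Nat.mul_pos hn (by omega)) hp.pos hv hw h1 hgv hg
  rw [adjoin_primitiveRoot_eq_bot h1 (by rw [hcop]; exact one_dvd 2)] at hbot
  refine sq_ne_intCast_of_mem_bot hbot (m := ZMod.χ₄ p * p) ?_ (by rw [hg2]; push_cast; ring)
  intro q hq
  rcases hχ with h | h
  · rw [h] at hq
    exact rat_sq_ne_prime hp q (by rw [hq]; push_cast; ring)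
  · rw [h] at hq
    have h2 : (0 : ℚ) < p := Nat.cast_pos.2 hp.pos
    push_cast at hq
    nlinarith [sq_nonneg q]

/-- Neither `√2` nor `√-2` lies in `ℚ(√-1)`. -/
theorem not_mem_adjoin_four_of_sq {u z : Ω} (hz : IsPrimitiveRoot z 8)
    (hu : u ^ 2 = 2 ∨ u ^ 2 = -2) : u ∉ ℚ⟮z ^ 2⟯ := by
  have := charZero_of_injective_algebraMap (algebraMap ℚ Ω).injective
  intro hmem
  obtain ⟨τ, hτ⟩ := exists_algEquiv_pow hz (by norm_num) (show Nat.Coprime 5 8 by norm_num)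
  have h4 := isPrimitiveRoot_eight_pow_four hz
  have hτ' : τ z = -z := by rw [hτ]; linear_combination z * h4
  have hfix := mem_adjoin_simple_iff_forall_algEquiv.1 hmem τ (by rw [map_pow, hτ']; ring)
  have hneg : τ u = -u := by
    rcases hu with hu | hu
    · rw [← add_inv_sq_of_isPrimitiveRoot_eight hz] at hu
      rcases sq_eq_sq_iff_eq_or_eq_neg.1 hu with rfl | rfl <;> simp [hτ', inv_neg] <;> ring
    · rw [← sub_inv_sq_of_isPrimitiveRoot_eight hz] at hu
      rcases sq_eq_sq_iff_eq_or_eq_neg.1 hu with rfl | rfl <;> simp [hτ', inv_neg] <;> ring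
  have h0 : u = 0 := by
    rw [hfix] at hneg
    exact self_eq_neg.1 hneg
  subst h0
  norm_num at hu

theorem dvd_of_squarefree_of_forall_prime_dvd {E n : ℕ} (hE : Squarefree E)
    (h : ∀ p, p.Prime → p ∣ E → p ∣ n) :
    E ∣ n := by
  rw [← Nat.prod_primeFactors_of_squarefree hE]
  exact Finset.prod_primes_dvd n (fun p hp => (Nat.prime_of_mem_primeFactors hp).prime)
    fun p hp => h p (Nat.prime_of_mem_primeFactors hp) (Nat.dvd_of_mem_primeFactors hp)

/-- The prime `2` is treated like the odd ones: if the power of `2` in the discriminant did not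
divide `n`, then one of `√-1`, `√2`, `√-2` would lie in too small a cyclotomic field. -/
theorem quadraticDiscr_dvd_of_sqrt_mem_adjoin {D n : ℕ} (hD : Squarefree D) (hn : 0 < n)
    (hn2 : 2 ∣ n) {r z : Ω} (hr : r ^ 2 = D) (hz : IsPrimitiveRoot z n) (hrz : r ∈ ℚ⟮z⟯) :
    quadraticDiscr D ∣ n := by
  have := charZero_of_injective_algebraMap (algebraMap ℚ Ω).injective
  have hDn : D ∣ n := by
    refine dvd_of_squarefree_of_forall_prime_dvd hD fun p hp hpD => ?_
    by_cases hp2 : p = 2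
    · rwa [hp2]
    · exact odd_prime_dvd_of_sqrt_mem_adjoin hD hn hr hz hrz hp hp2 hpD
  have hD0 : 0 < D := Nat.pos_of_ne_zero hD.ne_zero
  rcases Nat.even_or_odd D with hev | hodd
  · obtain ⟨E, rfl⟩ := hev.two_dvd
    have hE : Odd E := by
      rw [← Nat.not_even_iff_odd, even_iff_two_dvd]
      intro h2
      exact absurd (Nat.isUnit_iff.1 (hD 2 (Nat.mul_dvd_mul_left 2 h2))) (by norm_num)
    have hE0 : 0 < E := hE.pos
    have hEΩ : (E : Ω) ≠ 0 := Nat.cast_ne_zero.2 hE0.ne'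
    rw [quadraticDiscr, if_neg (by omega)]
    have h8n : 8 ∣ n := by
      by_contra h8
      obtain ⟨w, hw⟩ := exists_isPrimitiveRoot (Ω := Ω) hE0
      obtain ⟨g, hg, hg2⟩ := exists_sq_eq_odd_mem_adjoin hE hw
      -- `r / g` is a square root of `±2` in `ℚ(ζ_{nE}) ∩ ℚ(ζ₈) ⊆ ℚ(ζ₄)`
      obtain ⟨v, hv⟩ := exists_isPrimitiveRoot (Ω := Ω) (Nat.mul_pos hn hE0)
      have hu := div_mem_adjoin_mul hn hE0 hz hw hv hrz hg
      obtain ⟨y, hy⟩ := exists_isPrimitiveRoot (Ω := Ω) (n := 8) (by norm_num)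
      have hu2 : (r / g) ^ 2 = 2 ∨ (r / g) ^ 2 = -2 := by
        rw [div_pow, hr, hg2]
        rcases χ₄_eq_one_or_neg_one hE with h | h
        · left; rw [h]; push_cast; field_simp
        · right; rw [h]; push_cast; field_simp
      have huy : r / g ∈ ℚ⟮y⟯ := by
        have hyi := IntermediateField.mem_adjoin_simple_self ℚ y
        rcases hu2 with h | h
        · refine mem_of_sq_eq_sq (add_mem hyi (inv_mem hyi)) ?_
          rw [h, add_inv_sq_of_isPrimitiveRoot_eight hy]
        · refine mem_of_sq_eq_sq (sub_mem hyi (inv_mem hyi)) ?_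
          rw [h, sub_inv_sq_of_isPrimitiveRoot_eight hy]
      have hgcd : Nat.gcd (n * E) 8 ∣ 4 := by
        have h1 : Nat.gcd (n * E) 8 ∣ 2 ^ 3 := Nat.gcd_dvd_right _ _
        obtain ⟨i, hi, h2⟩ := (Nat.dvd_prime_pow Nat.prime_two).1 h1
        have h3 : i ≠ 3 := by
          rintro rfl
          have h4 : 8 ∣ n * E := by
            have := Nat.gcd_dvd_left (n * E) 8
            rwa [h2] at this
          exact h8 ((Nat.Coprime.pow_left 3 (Nat.coprime_two_left.2 hE)).dvd_of_dvd_mul_right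
            (show 2 ^ 3 ∣ n * E from h4))
        rw [h2]
        exact pow_dvd_pow 2 (show i ≤ 2 by omega)
      have hg0 : 0 < Nat.gcd (n * E) 8 := Nat.gcd_pos_of_pos_right _ (by norm_num)
      obtain ⟨x, hx⟩ := exists_isPrimitiveRoot (Ω := Ω) hg0
      have hux := mem_adjoin_gcd (Nat.mul_pos hn hE0) (by norm_num) hv hy hx hu huy
      refine not_mem_adjoin_four_of_sq hy hu2 ?_
      exact adjoin_primitiveRoot_le hx (hy.pow (by norm_num) (by norm_num : 8 = 2 * 4))
        (by norm_num) hgcd hux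
    have : 8 * E ∣ n := by
      refine Nat.Coprime.mul_dvd_of_dvd_of_dvd ?_ h8n ((Dvd.intro_left _ rfl).trans hDn)
      exact Nat.Coprime.pow_left 3 (Nat.coprime_two_left.2 hE)
    rwa [show 4 * (2 * E) = 8 * E by ring]
  · rw [quadraticDiscr]
    split_ifs with h1
    · exact hDn
    have h3 : D % 4 = 3 := (Nat.odd_mod_four_iff.1 (Nat.odd_iff.1 hodd)).resolve_left h1
    have hDΩ : (D : Ω) ≠ 0 := Nat.cast_ne_zero.2 hD0.ne'
    refine Nat.Coprime.mul_dvd_of_dvd_of_dvd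
      (Nat.Coprime.pow_left 2 (Nat.coprime_two_left.2 hodd)) ?_ hDn
    by_contra h4
    obtain ⟨w, hw⟩ := exists_isPrimitiveRoot (Ω := Ω) hD0
    obtain ⟨g, hg, hg2⟩ := exists_sq_eq_odd_mem_adjoin hodd hw
    -- `r / g` is a square root of `-1` in `ℚ(ζ_{nD}) ∩ ℚ(ζ₄) ⊆ ℚ`
    obtain ⟨v, hv⟩ := exists_isPrimitiveRoot (Ω := Ω) (Nat.mul_pos hn hD0)
    have hu := div_mem_adjoin_mul hn hD0 hz hw hv hrz hg
    obtain ⟨y, hy⟩ := exists_isPrimitiveRoot (Ω := Ω) (n := 4) (by norm_num)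
    have hu2 : (r / g) ^ 2 = -1 := by
      rw [div_pow, hr, hg2, ZMod.χ₄_nat_three_mod_four h3]
      push_cast; field_simp
    have huy : r / g ∈ ℚ⟮y⟯ := by
      refine mem_of_sq_eq_sq (IntermediateField.mem_adjoin_simple_self ℚ y) ?_
      rw [hu2, isPrimitiveRoot_four_sq hy]
    have hgcd : Nat.gcd (n * D) 4 ∣ 2 := by
      have h5 : Nat.gcd (n * D) 4 ∣ 2 ^ 2 := Nat.gcd_dvd_right _ _
      obtain ⟨i, hi, h2⟩ := (Nat.dvd_prime_pow Nat.prime_two).1 h5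
      have h6 : i ≠ 2 := by
        rintro rfl
        have h7 : 4 ∣ n * D := by
          have := Nat.gcd_dvd_left (n * D) 4
          rwa [h2] at this
        exact h4 ((Nat.Coprime.pow_left 2 (Nat.coprime_two_left.2 hodd)).dvd_of_dvd_mul_right
          (show 2 ^ 2 ∣ n * D from h7))
      rw [h2]
      exact pow_dvd_pow 2 (show i ≤ 1 by omega)
    have hg0 : 0 < Nat.gcd (n * D) 4 := Nat.gcd_pos_of_pos_right _ (by norm_num)
    obtain ⟨x, hx⟩ := exists_isPrimitiveRoot (Ω := Ω) hg0
    have hux := mem_adjoin_gcd (Nat.mul_pos hn hD0) (by norm_num) hv hy hx hu huy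
    rw [adjoin_primitiveRoot_eq_bot hx hgcd] at hux
    refine sq_ne_intCast_of_mem_bot hux (m := -1) (fun q hq => ?_) (by rw [hu2]; push_cast; ring)
    push_cast at hq
    nlinarith [sq_nonneg q]

theorem sqrt_mem_adjoin_iff_quadraticDiscr_dvd {D n : ℕ} (hD : Squarefree D) (hn : 0 < n)
    (hn2 : 2 ∣ n) {r z : Ω} (hr : r ^ 2 = D) (hz : IsPrimitiveRoot z n) :
    r ∈ ℚ⟮z⟯ ↔ quadraticDiscr D ∣ n := by
  refine ⟨quadraticDiscr_dvd_of_sqrt_mem_adjoin hD hn hn2 hr hz, ?_⟩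
  rintro ⟨c, rfl⟩
  have h1 := hz.pow hn (mul_comm _ _)
  exact IntermediateField.adjoin_simple_le_iff.2
    (pow_mem (IntermediateField.mem_adjoin_simple_self ℚ z) c)
    (mem_adjoin_quadraticDiscr hD hr h1)

end Conductor

/-! ### The discriminant of a quadratic field -/

section Discriminant

variable {K : Type*} [Field K] [NumberField K]

theorem exists_basis_one_of_forall_eq_add_mul {u : K}
    (hspan : ∀ x : K, ∃ p q : ℚ, x = algebraMap ℚ K p + algebraMap ℚ K q * u)
    (hu : ∀ q : ℚ, algebraMap ℚ K q ≠ u) :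
    ∃ b : Module.Basis (Fin 2) ℚ K, b 0 = 1 ∧ b 1 = u := by
  have hli : LinearIndependent ℚ ![1, u] := by
    rw [LinearIndependent.pair_iff]
    intro p q h
    rw [Algebra.smul_def, Algebra.smul_def, mul_one] at h
    have hq : q = 0 := by
      by_contra hq
      refine hu (-p / q) ?_
      have hq' : algebraMap ℚ K q ≠ 0 := by simpa using hq
      rw [map_div₀, map_neg, div_eq_iff hq']
      linear_combination -h
    subst hq
    refine ⟨?_, rfl⟩
    simpa using h
  have hsp : ⊤ ≤ Submodule.span ℚ (Set.range ![1, u]) := by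
    intro x _
    obtain ⟨p, q, rfl⟩ := hspan x
    simp only [Matrix.range_cons, Matrix.range_empty, Set.union_empty, Set.singleton_union]
    rw [Submodule.mem_span_pair]
    exact ⟨p, q, by rw [Algebra.smul_def, Algebra.smul_def, mul_one]⟩
  exact ⟨Module.Basis.mk hli hsp, by simp, by simp⟩

theorem basis_repr_add_mul {u : K} {b : Module.Basis (Fin 2) ℚ K} (h0 : b 0 = 1) (h1 : b 1 = u)
    (p q : ℚ) :
    b.repr (algebraMap ℚ K p + algebraMap ℚ K q * u) 0 = p ∧
      b.repr (algebraMap ℚ K p + algebraMap ℚ K q * u) 1 = q := by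
  have h : algebraMap ℚ K p + algebraMap ℚ K q * u = p • b 0 + q • b 1 := by
    rw [h0, h1, Algebra.smul_def, Algebra.smul_def, mul_one]
  rw [h]
  simp

theorem trace_eq_of_sq_eq {u : K} {b : Module.Basis (Fin 2) ℚ K} (h0 : b 0 = 1) (h1 : b 1 = u)
    {s t : ℚ} (hu : u ^ 2 = algebraMap ℚ K t + algebraMap ℚ K s * u) (p q : ℚ) :
    Algebra.trace ℚ K (algebraMap ℚ K p + algebraMap ℚ K q * u) = 2 * p + q * s := by
  rw [Algebra.trace_eq_matrix_trace b, Matrix.trace_fin_two, Algebra.leftMulMatrix_eq_repr_mul,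
    Algebra.leftMulMatrix_eq_repr_mul, h0, h1, mul_one, (basis_repr_add_mul h0 h1 p q).1]
  have h : (algebraMap ℚ K p + algebraMap ℚ K q * u) * u =
      algebraMap ℚ K (q * t) + algebraMap ℚ K (p + q * s) * u := by
    simp only [map_add, map_mul]
    linear_combination algebraMap ℚ K q * hu
  rw [h, (basis_repr_add_mul h0 h1 _ _).2]
  ring

theorem discr_basis_of_sq_eq {u : K} {b : Module.Basis (Fin 2) ℚ K} (h0 : b 0 = 1)
    (h1 : b 1 = u) {s t : ℚ} (hu : u ^ 2 = algebraMap ℚ K t + algebraMap ℚ K s * u) :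
    Algebra.discr ℚ b = s ^ 2 + 4 * t := by
  have e1 : Algebra.trace ℚ K 1 = 2 := by
    have := trace_eq_of_sq_eq h0 h1 hu 1 0
    simpa using this
  have e2 : Algebra.trace ℚ K u = s := by
    have := trace_eq_of_sq_eq h0 h1 hu 0 1
    simpa using this
  have e3 : Algebra.trace ℚ K (u * u) = 2 * t + s * s := by
    rw [← sq, hu, trace_eq_of_sq_eq h0 h1 hu]
  rw [Algebra.discr_def, Matrix.det_fin_two]
  simp only [Algebra.traceMatrix_apply, Algebra.traceForm_apply, h0, h1, e1, e3, mul_one, one_mul,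
    e2]
  ring

/-- If `1, u` is a `ℚ`-basis of `K` with `u` integral, and every algebraic integer of `K` has
integral coordinates in it, then its discriminant is the discriminant of `K`. -/
theorem discr_eq_of_integral_coordinates {u : K} {b : Module.Basis (Fin 2) ℚ K} (h0 : b 0 = 1)
    (h1 : b 1 = u) (hu : IsIntegral ℤ u)
    (hint : ∀ x : K, IsIntegral ℤ x → ∀ i, IsIntegral ℤ (b.repr x i)) :
    (NumberField.discr K : ℚ) = Algebra.discr ℚ b := by
  rw [NumberField.coe_discr]
  refine Algebra.discr_eq_discr_of_toMatrix_coeff_isIntegral K (fun i j => ?_) fun i j => ?_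
  · rw [Module.Basis.toMatrix_apply]
    have hb : IsIntegral ℤ (b j) := by
      fin_cases j
      · simpa [h0] using isIntegral_one
      · simpa [h1] using hu
    obtain ⟨y, hy⟩ : ∃ y, algebraMap (NumberField.RingOfIntegers K) K y = b j :=
      (IsIntegralClosure.isIntegral_iff (A := NumberField.RingOfIntegers K)).1 hb
    rw [← hy, NumberField.integralBasis_repr_apply]
    exact isIntegral_algebraMap
  · rw [Module.Basis.toMatrix_apply]
    refine hint _ ?_ i
    rw [NumberField.integralBasis_apply]
    exact NumberField.RingOfIntegers.isIntegral_coe _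

theorem exists_int_of_isIntegral_rat {q : ℚ} (h : IsIntegral ℤ q) : ∃ m : ℤ, (m : ℚ) = q :=
  IsIntegrallyClosed.isIntegral_iff.1 h

/-- If `D` is squarefree and `D k²` is an integer for a rational number `k`, then `k` is an
integer. -/
theorem exists_int_of_squarefree_mul_sq {D : ℕ} (hD : Squarefree D) {k : ℚ} {N : ℤ}
    (h : (D : ℚ) * k ^ 2 = N) : ∃ m : ℤ, (m : ℚ) = k := by
  have hden : (k.den : ℚ) ≠ 0 := Nat.cast_ne_zero.2 k.den_nz
  have h1 : (D : ℤ) * k.num ^ 2 = N * (k.den : ℤ) ^ 2 := by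
    have h2 : (D : ℚ) * (k.num : ℚ) ^ 2 = N * (k.den : ℚ) ^ 2 := by
      rw [← h]
      have h3 : k * k.den = k.num := Rat.mul_den_eq_num k
      rw [← h3]
      ring
    exact_mod_cast h2
  have h2 : k.den ^ 2 ∣ D * k.num.natAbs ^ 2 := by
    have := congrArg Int.natAbs h1
    rw [Int.natAbs_mul, Int.natAbs_mul, Int.natAbs_pow, Int.natAbs_pow] at this
    simp only [Int.natAbs_natCast] at this
    exact this ▸ Dvd.intro_left _ rfl
  have h3 : k.den ^ 2 ∣ D :=
    (Nat.Coprime.pow 2 2 k.reduced.symm).dvd_of_dvd_mul_right h2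
  have h4 : k.den = 1 := Nat.isUnit_iff.1 (hD k.den (by rwa [← sq]))
  exact ⟨k.num, by conv_rhs => rw [← Rat.num_div_den k, h4]; simp⟩

/-- The coordinates of an algebraic integer `p + q√D` satisfy `2p, 2q ∈ ℤ` and
`(2p)² ≡ D (2q)²` modulo `4`. -/
theorem exists_half_integers {D : ℕ} (hD : Squarefree D) {r : K} (hr : r ^ 2 = D)
    {b : Module.Basis (Fin 2) ℚ K} (h0 : b 0 = 1) (h1 : b 1 = r) {p q : ℚ}
    (hx : IsIntegral ℤ (algebraMap ℚ K p + algebraMap ℚ K q * r)) :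
    ∃ m k N : ℤ, p = m / 2 ∧ q = k / 2 ∧ m ^ 2 - D * k ^ 2 = 4 * N := by
  set x := algebraMap ℚ K p + algebraMap ℚ K q * r with hxdef
  have hu : r ^ 2 = algebraMap ℚ K D + algebraMap ℚ K 0 * r := by rw [hr]; simp
  obtain ⟨m, hm⟩ := exists_int_of_isIntegral_rat (Algebra.isIntegral_trace (L := ℚ) hx)
  rw [hxdef, trace_eq_of_sq_eq h0 h1 hu, mul_zero, add_zero] at hm
  have hN : IsIntegral ℤ (p ^ 2 - D * q ^ 2) := by
    rw [← isIntegral_algebraMap_iff (algebraMap ℚ K).injective]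
    have h2 : algebraMap ℚ K (p ^ 2 - D * q ^ 2) = x * (algebraMap ℤ K m - x) := by
      have h3 : algebraMap ℤ K m = algebraMap ℚ K (2 * p) := by rw [← hm]; simp
      rw [h3, hxdef]
      simp only [map_sub, map_mul, map_pow, map_natCast, map_ofNat]
      linear_combination (algebraMap ℚ K q) ^ 2 * hr
    rw [h2]
    exact hx.mul (isIntegral_algebraMap.sub hx)
  obtain ⟨N, hN⟩ := exists_int_of_isIntegral_rat hN
  obtain ⟨k, hk⟩ := exists_int_of_squarefree_mul_sq hD (k := 2 * q) (N := m ^ 2 - 4 * N) (by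
    push_cast
    rw [hm, hN]
    ring)
  refine ⟨m, k, N, by rw [hm]; ring, by rw [hk]; ring, ?_⟩
  have : (m : ℚ) ^ 2 - D * (k : ℚ) ^ 2 = 4 * N := by
    rw [hm, hk, hN]; ring
  exact_mod_cast this

/-- The ring of integers of `ℚ(√D)` is `ℤ[(1 + √D) / 2]` for `D ≡ 1` modulo `4`, and `ℤ[√D]`
otherwise. -/
theorem natAbs_discr_eq_quadraticDiscr {D : ℕ} (hD : Squarefree D) {r : K} (hr : r ^ 2 = D)
    (hspan : ∀ x : K, ∃ p q : ℚ, x = algebraMap ℚ K p + algebraMap ℚ K q * r)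
    (hrat : ∀ q : ℚ, algebraMap ℚ K q ≠ r) :
    (NumberField.discr K).natAbs = quadraticDiscr D := by
  obtain ⟨b, h0, h1⟩ := exists_basis_one_of_forall_eq_add_mul hspan hrat
  have hrint : IsIntegral ℤ r := by
    refine IsIntegral.of_pow (n := 2) (by norm_num) ?_
    rw [hr]
    exact isIntegral_natCast _
  suffices h : (NumberField.discr K : ℚ) = (quadraticDiscr D : ℕ) by
    have h' : NumberField.discr K = (quadraticDiscr D : ℕ) := by exact_mod_cast h
    rw [h', Int.natAbs_natCast]
  by_cases hmod : D % 4 = 1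
  · rw [quadraticDiscr, if_pos hmod]
    obtain ⟨E, hE⟩ : ∃ E : ℕ, D = 4 * E + 1 := ⟨D / 4, by omega⟩
    set ω : K := (1 + r) / 2 with hω
    have hrω : r = 2 * ω - 1 := by rw [hω]; ring
    have hω2 : ω ^ 2 = algebraMap ℚ K E + algebraMap ℚ K 1 * ω := by
      rw [hω]
      rw [hE] at hr
      push_cast at hr
      simp only [map_natCast, map_one]
      linear_combination hr / 4
    have hωint : IsIntegral ℤ ω := by
      have hr' : r ^ 2 = 4 * (E : K) + 1 := by rw [hr, hE]; push_cast; ring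
      refine ⟨Polynomial.X ^ 2 - Polynomial.X - Polynomial.C (E : ℤ), ?_, ?_⟩
      · monicity!
      · simp only [Polynomial.eval₂_sub, Polynomial.eval₂_X_pow, Polynomial.eval₂_X,
          Polynomial.eval₂_C]
        rw [hω2]
        simp
    have hspan' : ∀ x : K, ∃ p q : ℚ, x = algebraMap ℚ K p + algebraMap ℚ K q * ω := by
      intro x
      obtain ⟨p, q, rfl⟩ := hspan x
      refine ⟨p - q, 2 * q, ?_⟩
      rw [hrω]
      simp only [map_sub, map_mul, map_ofNat]
      ring
    have hrat' : ∀ q : ℚ, algebraMap ℚ K q ≠ ω := by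
      intro q hq
      refine hrat (2 * q - 1) ?_
      rw [hrω, ← hq]
      simp
    obtain ⟨b', h0', h1'⟩ := exists_basis_one_of_forall_eq_add_mul hspan' hrat'
    rw [discr_eq_of_integral_coordinates h0' h1' hωint, discr_basis_of_sq_eq h0' h1' hω2, hE]
    · push_cast; ring
    · intro x hx
      obtain ⟨p, q, rfl⟩ := hspan x
      obtain ⟨m, k, N, hp, hq, hN⟩ := exists_half_integers hD hr h0 h1 hx
      have hpar : 2 ∣ m - k := by
        rw [hE] at hN
        push_cast at hN
        have h3 : (m - k) * (m + k) = 4 * (N + E * k ^ 2) := by linear_combination hN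
        by_contra hodd
        have h4 : (m - k) % 2 = 1 := by omega
        have h5 : (m + k) % 2 = 1 := by omega
        have h6 : ((m - k) * (m + k)) % 2 = 1 := by rw [Int.mul_emod, h4, h5]; rfl
        omega
      obtain ⟨c, hc⟩ := hpar
      have h4 : algebraMap ℚ K p + algebraMap ℚ K q * r =
          algebraMap ℚ K c + algebraMap ℚ K k * ω := by
        have hc' : (m : ℚ) = 2 * c + k := by
          have : m = 2 * c + k := by omega
          exact_mod_cast this
        rw [hp, hq, hc', hrω]
        simp only [map_div₀, map_add, map_mul, map_ofNat]
        ring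
      rw [h4]
      have h5 := basis_repr_add_mul h0' h1' c k
      intro i
      fin_cases i
      · simp only [Fin.zero_eta, h5.1]; exact isIntegral_intCast _
      · simp only [Fin.mk_one, h5.2]; exact isIntegral_intCast _
  · rw [quadraticDiscr, if_neg hmod]
    have hr2 : r ^ 2 = algebraMap ℚ K D + algebraMap ℚ K 0 * r := by rw [hr]; simp
    rw [discr_eq_of_integral_coordinates h0 h1 hrint, discr_basis_of_sq_eq h0 h1 hr2]
    · push_cast; ring
    · intro x hx
      obtain ⟨p, q, rfl⟩ := hspan x
      obtain ⟨m, k, N, hp, hq, hN⟩ := exists_half_integers hD hr h0 h1 hx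
      have hD4 : D % 4 = 2 ∨ D % 4 = 3 := by
        have : D % 4 ≠ 0 := by
          intro h
          have := hD 2 (Nat.dvd_of_mod_eq_zero h)
          exact absurd (Nat.isUnit_iff.1 this) (by norm_num)
        omega
      have hpar : 2 ∣ m ∧ 2 ∣ k := by
        have hD' : (D : ℤ) = 4 * (D / 4 : ℤ) + D % 4 := by omega
        have key : ∀ z : ℤ, z % 2 = 0 ∧ z ^ 2 % 4 = 0 ∨ z % 2 = 1 ∧ z ^ 2 % 4 = 1 := by
          intro z
          rcases Int.emod_two_eq_zero_or_one z with h | h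
          · left
            obtain ⟨w, rfl⟩ := Int.dvd_of_emod_eq_zero h
            exact ⟨h, by ring_nf; omega⟩
          · right
            obtain ⟨w, rfl⟩ : ∃ w, z = 2 * w + 1 := ⟨z / 2, by omega⟩
            exact ⟨h, by ring_nf; omega⟩
        have h3 : (m ^ 2 - D * k ^ 2) % 4 = 0 := by rw [hN]; omega
        have h4 : (m ^ 2 - ((D : ℤ) % 4) * (k ^ 2 % 4)) % 4 = 0 := by
          rw [Int.sub_emod] at h3 ⊢
          rw [Int.mul_emod] at h3
          exact h3
        rcases hD4 with h | h <;>
        · have h' : (D : ℤ) % 4 = _ := congrArg Nat.cast h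
          push_cast at h'
          rw [h'] at h4
          rcases key m with hm | hm <;> rcases key k with hk | hk <;>
            rw [hk.2] at h4 <;> omega
      obtain ⟨⟨m', rfl⟩, ⟨k', rfl⟩⟩ := hpar
      have hp' : p = m' := by rw [hp]; push_cast; ring
      have hq' : q = k' := by rw [hq]; push_cast; ring
      have h5 := basis_repr_add_mul h0 h1 p q
      intro i
      fin_cases i
      · simp only [Fin.zero_eta, h5.1.trans hp']; exact isIntegral_intCast _
      · simp only [Fin.mk_one, h5.2.trans hq']; exact isIntegral_intCast _

end Discriminant

/-! ### Conjugate pairs and complex conjugation -/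

section ConjugatePair

variable {Ω : Type*} [Field Ω] [Algebra ℚ Ω]

/-- Complex conjugation inverts the roots of unity. -/
theorem complexConj_apply_of_pow_eq_one {ι : Ω →ₐ[ℚ] ℂ} {κ : Ω ≃ₐ[ℚ] Ω}
    (hκ : ∀ x, ι (κ x) = starRingEnd ℂ (ι x)) {ε : Ω} {n : ℕ} (hn : 0 < n) (hε : ε ^ n = 1) :
    κ ε = ε⁻¹ := by
  refine ι.injective (show ι (κ ε) = ι ε⁻¹ from ?_)
  have h1 : ‖ι ε‖ = 1 := by
    have : ‖ι ε‖ ^ n = 1 := by rw [← norm_pow, ← map_pow, hε, map_one, norm_one]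
    exact (pow_eq_one_iff_of_nonneg (norm_nonneg _) hn.ne').1 this
  rw [hκ, map_inv₀, Complex.inv_def, Complex.normSq_eq_norm_sq, h1]
  simp

/-- `a` and `b` are the two roots of an irreducible quadratic polynomial over `ℚ`. -/
structure IsConjugatePair (a b : Ω) : Prop where
  not_mem_bot : a ∉ (⊥ : IntermediateField ℚ Ω)
  add_mem_bot : a + b ∈ (⊥ : IntermediateField ℚ Ω)
  mul_mem_bot : a * b ∈ (⊥ : IntermediateField ℚ Ω)

theorem algEquiv_apply_of_mem_bot (σ : Ω ≃ₐ[ℚ] Ω) {x : Ω}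
    (hx : x ∈ (⊥ : IntermediateField ℚ Ω)) : σ x = x := by
  obtain ⟨q, rfl⟩ := IntermediateField.mem_bot.1 hx
  exact σ.commutes q

variable {a b : Ω}

theorem IsConjugatePair.ne (h : IsConjugatePair a b) : a ≠ b := by
  have := charZero_of_injective_algebraMap (algebraMap ℚ Ω).injective
  rintro rfl
  apply h.not_mem_bot
  have h2 : a = (a + a) / 2 := by ring
  rw [h2]
  exact div_mem h.add_mem_bot (ofNat_mem _ 2)

theorem IsConjugatePair.apply_eq_or (h : IsConjugatePair a b) (σ : Ω ≃ₐ[ℚ] Ω) :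
    σ a = a ∧ σ b = b ∨ σ a = b ∧ σ b = a := by
  have h1 := algEquiv_apply_of_mem_bot σ h.add_mem_bot
  have h2 := algEquiv_apply_of_mem_bot σ h.mul_mem_bot
  rw [map_add] at h1
  rw [map_mul] at h2
  have h3 : (σ a - a) * (σ a - b) = 0 := by
    linear_combination σ a * h1 - h2
  rcases mul_eq_zero.1 h3 with h4 | h4
  · left
    have h5 := sub_eq_zero.1 h4
    exact ⟨h5, by linear_combination h1 - h5⟩
  · right
    have h5 := sub_eq_zero.1 h4
    exact ⟨h5, by linear_combination h1 - h5⟩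

theorem IsConjugatePair.mem_right (h : IsConjugatePair a b) {K : IntermediateField ℚ Ω}
    (ha : a ∈ K) : b ∈ K := by
  have : b = (a + b) - a := by ring
  rw [this]
  exact sub_mem ((bot_le : ⊥ ≤ K) h.add_mem_bot) ha

theorem IsConjugatePair.apply_apply (h : IsConjugatePair a b) {x : Ω} (hx : x ∈ ℚ⟮a⟯)
    [IsAlgClosure ℚ Ω] {σ τ : Ω ≃ₐ[ℚ] Ω} (hσ : σ a = b) (hτ : τ a = b) : τ (σ x) = x := by
  have h1 : ∀ s ∈ ({a} : Set Ω), (τ * σ) s = (1 : Ω ≃ₐ[ℚ] Ω) s := by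
    rintro s rfl
    rcases h.apply_eq_or τ with h2 | h2
    · exact absurd (h2.1.symm.trans hτ) h.ne
    · rw [AlgEquiv.mul_apply, hσ, h2.2]; rfl
  exact algEquiv_eq_of_mem_adjoin hx h1

variable [IsAlgClosure ℚ Ω]

theorem IsConjugatePair.exists_apply_eq (h : IsConjugatePair a b) : ∃ σ : Ω ≃ₐ[ℚ] Ω, σ a = b := by
  by_contra! hcon
  apply h.not_mem_bot
  rw [InfiniteGalois.mem_bot_iff_fixed]
  intro σ
  rcases h.apply_eq_or σ with h1 | h1
  · exact h1.1
  · exact absurd h1.1 (hcon σ)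

theorem IsConjugatePair.mem_bot_iff (h : IsConjugatePair a b) {x : Ω} (hx : x ∈ ℚ⟮a⟯)
    {σ : Ω ≃ₐ[ℚ] Ω} (hσ : σ a = b) : x ∈ (⊥ : IntermediateField ℚ Ω) ↔ σ x = x := by
  refine ⟨algEquiv_apply_of_mem_bot σ, fun hfix => ?_⟩
  rw [InfiniteGalois.mem_bot_iff_fixed]
  intro τ
  rcases h.apply_eq_or τ with h1 | h1
  · exact mem_adjoin_simple_iff_forall_algEquiv.1 hx τ h1.1
  · rw [algEquiv_eq_of_mem_adjoin hx (τ := σ) (by rintro s rfl; rw [h1.1, hσ]), hfix]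

theorem IsConjugatePair.apply_mem (h : IsConjugatePair a b) {x : Ω} (hx : x ∈ ℚ⟮a⟯)
    (σ : Ω ≃ₐ[ℚ] Ω) : σ x ∈ ℚ⟮a⟯ := by
  rw [mem_adjoin_simple_iff_forall_algEquiv]
  intro τ hτ
  have h1 : ∀ s ∈ ({a} : Set Ω), (τ * σ) s = σ s := by
    rintro s rfl
    have h2 : τ b = b := by
      rcases h.apply_eq_or τ with h2 | h2
      · exact h2.2
      · exact absurd (hτ.symm.trans h2.1) h.ne
    rcases h.apply_eq_or σ with h3 | h3
    · rw [AlgEquiv.mul_apply, h3.1, hτ]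
    · rw [AlgEquiv.mul_apply, h3.1, h2]
  exact algEquiv_eq_of_mem_adjoin hx h1

/-- In the quadratic field `K = ℚ(a)` the norm of `x` is `x σ(x)`, where `σ` is the nontrivial
automorphism. The algebra structure on `K` is left free, as the instance found for `Algebra.norm`
need not be the one of an intermediate field. -/
theorem IsConjugatePair.norm_eq (h : IsConjugatePair a b) {K : IntermediateField ℚ Ω}
    (hK : K = ℚ⟮a⟯) [inst : Algebra ℚ K] (x : K) {σ : Ω ≃ₐ[ℚ] Ω} (hσ : σ a = b) :
    algebraMap ℚ Ω (Algebra.norm ℚ x) = x * σ x := by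
  classical
  have := IsAlgClosure.isAlgClosed ℚ (K := Ω)
  have haK : a ∈ K := hK ▸ IntermediateField.mem_adjoin_simple_self ℚ a
  have : @FiniteDimensional ℚ K _ _ inst.toModule := by
    have hfin : FiniteDimensional ℚ ℚ⟮a⟯ :=
      IntermediateField.adjoin.finiteDimensional (Algebra.IsIntegral.isIntegral a)
    rw [← hK] at hfin
    convert hfin using 1
    exact Subsingleton.elim _ _
  let j : K →ₐ[ℚ] Ω := (K.val : K →+* Ω).toRatAlgHom
  have hj : ∀ y : K, j y = y := fun _ => rfl
  have hne : j ≠ σ.toAlgHom.comp j := by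
    intro heq
    have := DFunLike.congr_fun heq ⟨a, haK⟩
    exact h.ne (this.trans hσ)
  -- an embedding of `K` is determined by the image of `a`, which is `a` or `b`
  have hext : ∀ φ ψ : K →ₐ[ℚ] Ω, φ ⟨a, haK⟩ = ψ ⟨a, haK⟩ → φ = ψ := by
    intro φ ψ hφψ
    have key : ∀ y (hy : y ∈ ℚ⟮a⟯), φ ⟨y, hK ▸ hy⟩ = ψ ⟨y, hK ▸ hy⟩ := by
      intro y hy
      induction hy using IntermediateField.adjoin_induction with
      | mem y hy => obtain rfl : y = a := hy; exact hφψ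
      | algebraMap q =>
        have hq : (⟨algebraMap ℚ Ω q, K.algebraMap_mem q⟩ : K) = algebraMap ℚ K q :=
          j.injective ((hj _).trans (j.commutes q).symm)
        rw [hq, AlgHom.commutes, AlgHom.commutes]
      | add y z hy hz hy' hz' =>
        have := congrArg₂ (· + ·) hy' hz'
        simp only [← map_add] at this
        exact this
      | inv y hy hy' =>
        have := congrArg (·⁻¹) hy'
        simp only [← map_inv₀] at this
        exact this
      | mul y z hy hz hy' hz' =>
        have := congrArg₂ (· * ·) hy' hz'
        simp only [← map_mul] at this
        exact this
    ext y
    exact key y (hK ▸ y.2)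
  have huniv : (Finset.univ : Finset (K →ₐ[ℚ] Ω)) = {j, σ.toAlgHom.comp j} := by
    symm
    rw [Finset.eq_univ_iff_forall]
    intro φ
    rw [Finset.mem_insert, Finset.mem_singleton]
    have hroot : φ ⟨a, haK⟩ = a ∨ φ ⟨a, haK⟩ = b := by
      have hconj : IsConjRoot ℚ (φ ⟨a, haK⟩) a :=
        (minpoly.algHom_eq φ φ.injective ⟨a, haK⟩).trans
          (minpoly.algHom_eq j j.injective ⟨a, haK⟩).symm
      obtain ⟨τ, hτ⟩ := hconj.exists_algEquiv
      rw [← hτ]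
      rcases h.apply_eq_or τ with h1 | h1
      · exact Or.inl h1.1
      · exact Or.inr h1.1
    exact hroot.imp (fun h1 => hext _ _ h1) fun h1 => hext _ _ (h1.trans hσ.symm)
  rw [Algebra.norm_eq_prod_embeddings ℚ Ω x, huniv, Finset.prod_pair hne]
  rfl

/-- `Ω` carries a complex conjugation, through an embedding into `ℂ`. -/
theorem exists_complexConj (Ω : Type*) [Field Ω] [Algebra ℚ Ω] [IsAlgClosure ℚ Ω] :
    ∃ (ι : Ω →ₐ[ℚ] ℂ) (κ : Ω ≃ₐ[ℚ] Ω), ∀ x, ι (κ x) = starRingEnd ℂ (ι x) := by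
  let ι : Ω →ₐ[ℚ] ℂ := IsAlgClosed.lift
  let _ : Algebra Ω ℂ := ι.toRingHom.toAlgebra
  have : IsScalarTower ℚ Ω ℂ := IsScalarTower.of_algebraMap_eq fun q => (ι.commutes q).symm
  let c : ℂ ≃ₐ[ℚ] ℂ := Complex.conjAe.restrictScalars ℚ
  exact ⟨ι, c.restrictNormal Ω, fun x => c.restrictNormal_commutes Ω x⟩

/-- A quadratic field containing an element of norm `-1` is real. -/
theorem IsConjugatePair.complexConj_apply (h : IsConjugatePair a b) {ι : Ω →ₐ[ℚ] ℂ}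
    {κ : Ω ≃ₐ[ℚ] Ω} (hκ : ∀ x, ι (κ x) = starRingEnd ℂ (ι x)) {σ : Ω ≃ₐ[ℚ] Ω} (hσ : σ a = b)
    {c : Ω} (hc : c ∈ ℚ⟮a⟯) (hcσ : c * σ c = -1) : κ a = a := by
  rcases h.apply_eq_or κ with h1 | h1
  · exact h1.1
  · exfalso
    rw [algEquiv_eq_of_mem_adjoin hc (τ := κ) (by rintro s rfl; rw [h1.1, hσ])] at hcσ
    have h2 := congrArg ι hcσ
    rw [map_mul, hκ, Complex.mul_conj, map_neg, map_one] at h2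
    have h3 := congrArg Complex.re h2
    simp only [Complex.ofReal_re, Complex.neg_re, Complex.one_re] at h3
    linarith [Complex.normSq_nonneg (ι c)]

end ConjugatePair

/-! ### The power index -/

section PowerIndex

variable {Ω : Type*} [Field Ω] [Algebra ℚ Ω]

/-- If `γ` is an `m`-th and an `n`-th power in `K`, then it is an `lcm(m, n)`-th power. -/
theorem exists_pow_lcm_eq {K : IntermediateField ℚ Ω} {γ x y : Ω} {m n : ℕ} (hm : m ≠ 0)
    (hn : n ≠ 0) (hγ : γ ≠ 0) (hx : x ∈ K) (hy : y ∈ K) (hxm : x ^ m = γ) (hyn : y ^ n = γ) :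
    ∃ z ∈ K, z ^ Nat.lcm m n = γ := by
  -- `lcm m n` is a product of coprime divisors of `m` and `n`, to which Bézout's identity applies
  set m' := Nat.factorizationLCMLeft m n
  set n' := Nat.factorizationLCMRight m n
  have hcop : Nat.Coprime m' n' := Nat.coprime_factorizationLCMLeft_factorizationLCMRight m n
  obtain ⟨k, hk⟩ : m' ∣ m := Nat.factorizationLCMLeft_dvd_left m n
  obtain ⟨l, hl⟩ : n' ∣ n := Nat.factorizationLCMRight_dvd_right m n
  have hx' : (x ^ k) ^ m' = γ := by rw [← pow_mul, mul_comm, ← hk, hxm]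
  have hy' : (y ^ l) ^ n' = γ := by rw [← pow_mul, mul_comm, ← hl, hyn]
  have hxK := pow_mem hx k
  have hyK := pow_mem hy l
  generalize x ^ k = X at hx' hxK
  generalize y ^ l = Y at hy' hyK
  have hbez := Nat.gcd_eq_gcd_ab m' n'
  rw [hcop] at hbez
  refine ⟨X ^ (Nat.gcdB m' n') * Y ^ (Nat.gcdA m' n'),
    mul_mem (zpow_mem hxK _) (zpow_mem hyK _), ?_⟩
  rw [← Nat.factorizationLCMLeft_mul_factorizationLCMRight hm hn, mul_pow]
  change (X ^ (Nat.gcdB m' n')) ^ (m' * n') * (Y ^ (Nat.gcdA m' n')) ^ (m' * n') = γ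
  have e1 : (X ^ (Nat.gcdB m' n')) ^ (m' * n') = γ ^ ((n' : ℤ) * Nat.gcdB m' n') := by
    conv_rhs => rw [← hx']
    simp only [← zpow_natCast, ← zpow_mul]
    congr 1; push_cast; ring
  have e2 : (Y ^ (Nat.gcdA m' n')) ^ (m' * n') = γ ^ ((m' : ℤ) * Nat.gcdA m' n') := by
    conv_rhs => rw [← hy']
    simp only [← zpow_natCast, ← zpow_mul]
    congr 1; push_cast; ring
  rw [e1, e2, ← zpow_add₀ hγ, add_comm, ← hbez]
  simp

/-- If `h` is the nonzero power index of `γ` in `K`, then `γ` is an `n`-th power in `K` exactly for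
the divisors `n` of `h`. A nonzero value rules out the default value of an unbounded supremum. -/
theorem powerIndex_spec {K : IntermediateField ℚ Ω} {γ : Ω} (hγ : γ ≠ 0) {h : ℕ}
    (hh : h = powerIndex K γ) (h0 : h ≠ 0) :
    (∃ c ∈ K, c ^ h = γ) ∧ ∀ n ≠ 0, ∀ y ∈ K, y ^ n = γ → n ∣ h := by
  set S := {n : ℕ | 1 ≤ n ∧ ∃ y : K, y ≠ 0 ∧ (y : Ω) ^ n = γ} with hS
  have hsup : h = sSup S := hh
  have hbdd : BddAbove S := by
    by_contra hb
    exact h0 (hsup.trans (Nat.sSup_of_not_bddAbove hb))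
  have hne : S.Nonempty := ⟨1, le_rfl, by
    by_contra hcon
    have hemp : S = ∅ := by
      rw [Set.eq_empty_iff_forall_notMem]
      rintro n ⟨hn, y, hy, hyn⟩
      refine hcon ⟨y ^ n, pow_ne_zero n hy, ?_⟩
      simpa using hyn
    exact h0 (by rw [hsup, hemp]; simp)⟩
  obtain ⟨-, ⟨c, hcK⟩, -, hc⟩ : h ∈ S := hsup ▸ Nat.sSup_mem hne hbdd
  refine ⟨⟨c, hcK, hc⟩, fun n hn y hy hyn => ?_⟩
  obtain ⟨z, hz, hzl⟩ := exists_pow_lcm_eq hn h0 hγ hy hcK hyn hc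
  have hl : 0 < Nat.lcm n h := Nat.lcm_pos (Nat.pos_of_ne_zero hn) (Nat.pos_of_ne_zero h0)
  have hmem : Nat.lcm n h ∈ S := by
    refine ⟨hl, ⟨z, hz⟩, ?_, hzl⟩
    intro hz0
    have : z = 0 := congrArg Subtype.val hz0
    rw [this, zero_pow hl.ne'] at hzl
    exact hγ hzl.symm
  have hle : Nat.lcm n h ≤ h := (le_csSup hbdd hmem).trans_eq hsup.symm
  have heq : Nat.lcm n h = h :=
    le_antisymm hle (Nat.le_of_dvd hl (Nat.dvd_lcm_right n h))
  exact heq ▸ Nat.dvd_lcm_left n h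

end PowerIndex

/-! ### Degrees as numbers of conjugates -/

section Degree

variable {Ω : Type*} [Field Ω] [Algebra ℚ Ω] [IsAlgClosure ℚ Ω]

/-- The degree of a simple extension is the number of conjugates of its generator. -/
theorem finrank_adjoin_insert (S : Set Ω) (x : Ω) :
    Module.finrank ℚ (IntermediateField.adjoin ℚ (insert x S)) =
      Module.finrank ℚ (IntermediateField.adjoin ℚ S) *
        Nat.card {y : Ω // ∃ τ : Ω ≃ₐ[ℚ] Ω, (∀ s ∈ S, τ s = s) ∧ τ x = y} := by
  have := IsAlgClosure.isAlgClosed ℚ (K := Ω)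
  set F := IntermediateField.adjoin ℚ S with hF
  have hint : IsIntegral F x := Algebra.IsIntegral.isIntegral x
  have h1 : IntermediateField.adjoin ℚ (insert x S) = (F⟮x⟯).restrictScalars ℚ := by
    have := IntermediateField.adjoin_adjoin_left ℚ S {x}
    rw [Set.union_singleton] at this
    exact this.symm
  have h2 : Module.finrank ℚ (IntermediateField.adjoin ℚ (insert x S)) =
      Module.finrank ℚ F⟮x⟯ := by
    rw [h1]; rfl
  have h3 : Nat.card {y : Ω // ∃ τ : Ω ≃ₐ[ℚ] Ω, (∀ s ∈ S, τ s = s) ∧ τ x = y} =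
      Nat.card ((minpoly F x).rootSet Ω) := by
    refine Nat.card_congr (Equiv.subtypeEquivRight fun y => ?_)
    rw [← isConjRoot_iff_mem_minpoly_rootSet hint]
    constructor
    · rintro ⟨τ, hτ, rfl⟩
      have hfix : τ ∈ F.fixingSubgroup := by
        rw [IntermediateField.mem_fixingSubgroup_iff]
        intro y hy
        exact mem_adjoin_iff_forall_algEquiv.1 hy τ hτ
      exact (isConjRoot_iff_exists_algEquiv.2 ⟨F.fixingSubgroupEquiv ⟨τ, hfix⟩, rfl⟩).symm
    · intro hy
      obtain ⟨τ, hτ⟩ := hy.symm.exists_algEquiv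
      refine ⟨τ.restrictScalars ℚ, fun s hs => ?_, hτ⟩
      exact τ.commutes ⟨s, IntermediateField.subset_adjoin _ _ hs⟩
  rw [h2, h3, Nat.card_eq_fintype_card, Polynomial.card_rootSet_eq_natDegree
    (Algebra.IsSeparable.isSeparable F x) (IsAlgClosed.splits _),
    ← IntermediateField.adjoin.finrank hint, Module.finrank_mul_finrank]

end Degree

/-! ### Kummer theory over cyclotomic fields -/

section Kummer

variable {Ω : Type*} [Field Ω] [Algebra ℚ Ω]

/-- The quadratic field `ℚ(a)` with conjugate generators `a` and `b`, in which `γ` is an `n`-th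
power exactly for the divisors `n` of the even number `h`, and an `h`-th root `c ∈ ℚ(a)` of `γ`
of norm `-1`. -/
structure IsKummerDatum (a b γ c : Ω) (h : ℕ) : Prop extends IsConjugatePair a b where
  mem : c ∈ ℚ⟮a⟯
  pow_eq : c ^ h = γ
  ne_zero : h ≠ 0
  two_dvd : 2 ∣ h
  mul_apply : ∀ σ : Ω ≃ₐ[ℚ] Ω, σ a = b → c * σ c = -1
  dvd_of_pow_eq : ∀ n ≠ 0, ∀ y ∈ ℚ⟮a⟯, y ^ n = γ → n ∣ h

namespace IsKummerDatum

variable {a b γ c : Ω} {h : ℕ}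

theorem base_mem (H : IsKummerDatum a b γ c h) : γ ∈ ℚ⟮a⟯ := H.pow_eq ▸ pow_mem H.mem h

variable [IsAlgClosure ℚ Ω]

theorem root_ne_zero (H : IsKummerDatum a b γ c h) : c ≠ 0 := by
  obtain ⟨σ, hσ⟩ := H.exists_apply_eq
  rintro rfl
  simpa using H.mul_apply σ hσ

theorem base_ne_zero (H : IsKummerDatum a b γ c h) : γ ≠ 0 :=
  H.pow_eq ▸ pow_ne_zero h H.root_ne_zero

theorem algEquiv_eq_of_mem_adjoin_pair {ζ x : Ω} (hx : x ∈ IntermediateField.adjoin ℚ {a, ζ})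
    {σ τ : Ω ≃ₐ[ℚ] Ω} (ha : σ a = τ a) (hζ : σ ζ = τ ζ) : σ x = τ x := by
  refine algEquiv_eq_of_mem_adjoin hx fun s hs => ?_
  rcases hs with rfl | rfl
  · exact ha
  · exact hζ

/-- Adjoining roots of unity does not create new `t`-th roots of `γ`, as long as `t` is not
divisible by the full power `h₂` of `2`. For odd `t`, a root `y` in `ℚ(a, ζ)` gives the root
`y κ(y)` of `γ²` in `ℚ(a)`, where `κ` is the complex conjugation, which commutes with
`Gal(ℚ(a, ζ)/ℚ)`. -/
theorem dvd_of_pow_eq_of_mem_adjoin (H : IsKummerDatum a b γ c h) {ζ y : Ω} {n t : ℕ}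
    (hn : 0 < n) (hζ : IsPrimitiveRoot ζ n) (hy : y ∈ IntermediateField.adjoin ℚ {a, ζ})
    (ht : t ≠ 0) (hyt : y ^ t = γ) (hqt : ¬ gcdInfty h 2 ∣ t) : t ∣ h := by
  have : NeZero n := ⟨hn.ne'⟩
  obtain ⟨i, s, hs, rfl⟩ := Nat.exists_eq_two_pow_mul_odd ht
  have h2h : 2 ^ i ∣ h := by
    refine dvd_trans ?_ (gcdInfty_dvd H.ne_zero 2)
    rw [gcdInfty_two] at hqt ⊢
    refine pow_dvd_pow 2 (le_of_not_ge fun hle => hqt ?_)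
    exact (pow_dvd_pow 2 hle).mul_right s
  refine Nat.Coprime.mul_dvd_of_dvd_of_dvd (Nat.Coprime.pow_left i
    (Nat.coprime_two_left.2 hs)) h2h ?_
  have hy' := pow_mem hy (2 ^ i)
  rw [pow_mul] at hyt
  generalize y ^ 2 ^ i = y' at hyt hy'
  obtain ⟨ι, κ, hκ⟩ := exists_complexConj Ω
  obtain ⟨σ, hσ⟩ := H.exists_apply_eq
  have hκa : κ a = a := H.complexConj_apply hκ hσ H.mem (H.mul_apply σ hσ)
  have hκγ : κ γ = γ := mem_adjoin_simple_iff_forall_algEquiv.1 H.base_mem κ hκa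
  have hy0 : y' ≠ 0 := by
    rintro rfl
    exact H.base_ne_zero (hyt ▸ zero_pow hs.pos.ne')
  have hw : y' * κ y' ∈ ℚ⟮a⟯ := by
    rw [mem_adjoin_simple_iff_forall_algEquiv]
    intro τ hτ
    have hτγ : τ γ = γ := mem_adjoin_simple_iff_forall_algEquiv.1 H.base_mem τ hτ
    -- `τ` multiplies `y'` by a root of unity, and hence `κ y'` by its inverse
    have hε : (τ y' / y') ^ s = 1 := by
      rw [div_pow, ← map_pow, hyt, hτγ, div_self H.base_ne_zero]
    have hcomm : (τ * κ) y' = (κ * τ) y' := by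
      refine algEquiv_eq_of_mem_adjoin_pair hy' ?_ ?_
      · simp only [AlgEquiv.mul_apply, hκa, hτ]
      · have hτζ : (τ ζ) ^ n = 1 := by rw [← map_pow, hζ.pow_eq_one, map_one]
        simp only [AlgEquiv.mul_apply, complexConj_apply_of_pow_eq_one hκ hn hζ.pow_eq_one,
          complexConj_apply_of_pow_eq_one hκ hn hτζ, map_inv₀]
    have hτy : τ y' = (τ y' / y') * y' := (div_mul_cancel₀ _ hy0).symm
    rw [map_mul, show τ (κ y') = κ (τ y') from hcomm, hτy, map_mul,
      complexConj_apply_of_pow_eq_one hκ hs.pos hε]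
    have hτy0 : τ y' ≠ 0 := (map_ne_zero τ).2 hy0
    field_simp
  have hws : (y' * κ y') ^ s = γ ^ 2 := by
    rw [mul_pow, ← map_pow, hyt, hκγ, sq]
  -- for `s = 2 k + 1`, the quotient of `γ ^ s` by the `k`-th power of `γ ^ 2` is `γ`
  obtain ⟨k, rfl⟩ := hs
  refine H.dvd_of_pow_eq _ (Nat.succ_ne_zero _) (γ / (y' * κ y') ^ k)
    (div_mem H.base_mem (pow_mem hw k)) ?_
  have hγ := H.base_ne_zero
  rw [div_pow, ← pow_mul, mul_comm k, pow_mul, hws, ← pow_mul, pow_succ,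
    mul_div_cancel_left₀ _ (pow_ne_zero _ hγ)]

variable {ζ ρ : Ω} {m n : ℕ}

/-- The power `ρ ^ (m / (m, h))` of an `m`-th root of `γ` lies in `ℚ(a, ζ)`, since it differs from
`c ^ (h / (m, h))` by a root of unity. -/
theorem exists_pow_div_gcd_eq (H : IsKummerDatum a b γ c h) (hmn : m ∣ n)
    (hρ : ρ ^ m = γ) : ∃ ε : Ω, ε ^ n = 1 ∧
      ρ ^ (m / Nat.gcd m h) = ε * c ^ (h / Nat.gcd m h) := by
  set g := Nat.gcd m h
  have hg : g ∣ h := Nat.gcd_dvd_right m h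
  have hc0 : c ^ (h / g) ≠ 0 := pow_ne_zero _ H.root_ne_zero
  refine ⟨ρ ^ (m / g) / c ^ (h / g), ?_, (div_mul_cancel₀ _ hc0).symm⟩
  obtain ⟨k, hk⟩ := (Nat.gcd_dvd_left m h).trans hmn
  rw [hk, pow_mul, div_pow, ← pow_mul, Nat.div_mul_cancel (Nat.gcd_dvd_left m h), hρ,
    ← pow_mul, Nat.div_mul_cancel hg, H.pow_eq, div_self H.base_ne_zero, one_pow]

/-- Kummer theory for `ρ = γ^{1/m}` over `ℚ(a, ζ)`: the conjugates of `ρ` are its products with the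
roots of unity of order dividing `m / (m, h)`. -/
theorem exists_algEquiv_mul (H : IsKummerDatum a b γ c h) (hn : 0 < n) (hζ : IsPrimitiveRoot ζ n)
    (hm : 0 < m) (hmn : m ∣ n) (hρ : ρ ^ m = γ) (hqm : ¬ gcdInfty h 2 ∣ m) {ε : Ω}
    (hε : ε ^ (m / Nat.gcd m h) = 1) :
    ∃ τ : Ω ≃ₐ[ℚ] Ω, τ a = a ∧ τ ζ = ζ ∧ τ ρ = ε * ρ := by
  have : NeZero m := ⟨hm.ne'⟩
  have hρ0 : ρ ≠ 0 := by
    rintro rfl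
    exact H.base_ne_zero (hρ ▸ zero_pow hm.ne')
  have hfixγ : ∀ τ : Ω ≃ₐ[ℚ] Ω, τ a = a → τ γ = γ :=
    mem_adjoin_simple_iff_forall_algEquiv.1 H.base_mem
  have hpow : ∀ (τ : Ω ≃ₐ[ℚ] Ω) (u : Ω), τ a = a → τ ρ = u * ρ → u ^ m = 1 := by
    intro τ u hτ hu
    have h1 : (u * ρ) ^ m = γ := by rw [← hu, ← map_pow, hρ, hfixγ τ hτ]
    rw [mul_pow, hρ] at h1
    exact mul_right_cancel₀ H.base_ne_zero (h1.trans (one_mul γ).symm)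
  have hfix : ∀ (τ : Ω ≃ₐ[ℚ] Ω) (u : Ω), τ ζ = ζ → u ^ m = 1 → τ u = u := by
    intro τ u hτ hu
    refine mem_adjoin_simple_iff_forall_algEquiv.1 (mem_adjoin_of_pow_eq_one hζ hn ?_) τ hτ
    obtain ⟨k, rfl⟩ := hmn
    rw [pow_mul, hu, one_pow]
  -- the Galois group over `ℚ(a, ζ)`, seen as a group of roots of unity through its action on `ρ`
  let G : Subgroup Ωˣ :=
    { carrier := {u | ∃ τ : Ω ≃ₐ[ℚ] Ω, τ a = a ∧ τ ζ = ζ ∧ τ ρ = u * ρ}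
      one_mem' := ⟨1, rfl, rfl, by simp⟩
      mul_mem' := by
        rintro u v ⟨τ, h1, h2, h3⟩ ⟨τ', h1', h2', h3'⟩
        refine ⟨τ * τ', by rw [AlgEquiv.mul_apply, h1', h1],
          by rw [AlgEquiv.mul_apply, h2', h2], ?_⟩
        rw [AlgEquiv.mul_apply, h3', map_mul, h3, hfix τ _ h2 (hpow τ' _ h1' h3'), Units.val_mul]
        ring
      inv_mem' := by
        rintro u ⟨τ, h1, h2, h3⟩
        have hinv : ∀ x : Ω, τ x = x → τ⁻¹ x = x := fun x hx =>
          τ.injective ((τ.apply_symm_apply x).trans hx.symm)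
        refine ⟨τ⁻¹, hinv a h1, hinv ζ h2, τ.injective ((τ.apply_symm_apply ρ).trans ?_)⟩
        rw [map_mul, h3, Units.val_inv_eq_inv_val, map_inv₀, hfix τ _ h2 (hpow τ _ h1 h3),
          inv_mul_cancel_left₀ u.ne_zero] }
  have hGm : G ≤ rootsOfUnity m Ω := by
    rintro u ⟨τ, h1, -, h3⟩
    exact (mem_rootsOfUnity' m u).2 (hpow τ _ h1 h3)
  have : Finite G := Finite.of_injective _ (Subgroup.inclusion_injective hGm)
  set t := Nat.card G with ht
  have ht0 : 0 < t := Nat.card_pos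
  have hGpow : ∀ u ∈ G, u ^ t = 1 := fun u hu => by
    have := pow_card_eq_one' (x := (⟨u, hu⟩ : G))
    exact congrArg Subtype.val this
  obtain ⟨z, hz⟩ := exists_isPrimitiveRoot (Ω := Ω) hm
  have htm : t ∣ m := hz.card_rootsOfUnity ▸ Subgroup.card_dvd_of_le hGm
  -- `ρ ^ t` is fixed by the Galois group over `ℚ(a, ζ)`
  have hmem : ρ ^ t ∈ IntermediateField.adjoin ℚ {a, ζ} := by
    rw [mem_adjoin_iff_forall_algEquiv]
    intro τ hτ
    have hτa : τ a = a := hτ a (by simp)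
    have hτζ : τ ζ = ζ := hτ ζ (by simp)
    have hu0 : τ ρ / ρ ≠ 0 := div_ne_zero ((map_ne_zero τ).2 hρ0) hρ0
    have hτρ : τ ρ = τ ρ / ρ * ρ := (div_mul_cancel₀ _ hρ0).symm
    have h1 := congrArg Units.val (hGpow (Units.mk0 _ hu0) ⟨τ, hτa, hτζ, hτρ⟩)
    simp only [Units.val_pow_eq_pow_val, Units.val_mk0, Units.val_one] at h1
    rw [map_pow, hτρ, mul_pow, h1, one_mul]
  have hdvd : m / t ∣ Nat.gcd m h := by
    refine Nat.dvd_gcd (Nat.div_dvd_of_dvd htm) (H.dvd_of_pow_eq_of_mem_adjoin hn hζ hmem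
      (Nat.div_pos (Nat.le_of_dvd hm htm) ht0).ne' ?_ fun hq => hqm
        (hq.trans (Nat.div_dvd_of_dvd htm)))
    rw [← pow_mul, Nat.mul_div_cancel' htm, hρ]
  have hSt : m / Nat.gcd m h ∣ t := by
    rw [Nat.div_dvd_iff_dvd_mul (Nat.gcd_dvd_left m h) (Nat.gcd_pos_of_pos_left h hm)]
    calc m = m / t * t := (Nat.div_mul_cancel htm).symm
      _ ∣ Nat.gcd m h * t := mul_dvd_mul_right hdvd t
  have hGt : G = rootsOfUnity t Ω := by
    have : NeZero t := ⟨ht0.ne'⟩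
    refine Subgroup.eq_of_le_of_card_ge (fun u hu => hGpow u hu) ?_
    exact card_rootsOfUnity Ω t
  have hε0 : ε ≠ 0 := by
    rintro rfl
    rw [zero_pow] at hε
    · exact zero_ne_one hε
    · exact (Nat.div_pos (Nat.gcd_le_left h hm) (Nat.gcd_pos_of_pos_left h hm)).ne'
  have hεG : Units.mk0 ε hε0 ∈ G := by
    rw [hGt, mem_rootsOfUnity']
    obtain ⟨k, hk⟩ := hSt
    rw [hk, pow_mul, Units.val_mk0, hε, one_pow]
  exact hεG

end IsKummerDatum

end Kummer

/-! ### The degree of `K_{n,m}` and the automorphism `σ_{u,v}` -/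

section Sigma

variable {Ω : Type*} [Field Ω] [Algebra ℚ Ω] [IsAlgClosure ℚ Ω] {a b ζ ρ : Ω}

/-- The condition defining `SigmaExists` in terms of automorphisms of the algebraic closure. -/
theorem IsConjugatePair.sigmaExists_iff (H : IsConjugatePair a b) {Δ : ℤ}
    (hΔ : (a - b) ^ 2 = (Δ : Ω)) :
    SigmaExists Δ a ζ ρ ↔ ∃ σ : Ω ≃ₐ[ℚ] Ω, σ a = b ∧ σ ζ = ζ⁻¹ ∧ σ ρ = ρ⁻¹ := by
  have hmem : ∀ x ∈ ({a, ζ, ρ} : Set Ω), x ∈ kummerField a ζ ρ := fun x hx =>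
    IntermediateField.subset_adjoin _ _ hx
  have haL : a ∈ kummerField a ζ ρ := hmem a (by simp)
  have hζL : ζ ∈ kummerField a ζ ρ := hmem ζ (by simp)
  have hρL : ρ ∈ kummerField a ζ ρ := hmem ρ (by simp)
  constructor
  · rintro ⟨σ, s, z, r, hs, hz, hr, hσs, hσz, hσr⟩
    refine ⟨σ.liftNormal Ω, ?_, ?_, ?_⟩
    · have := charZero_of_injective_algebraMap (algebraMap ℚ Ω).injective
      have h1 : (σ.liftNormal Ω) (s : Ω) = -(s : Ω) :=
        (σ.liftNormal_commutes Ω s).trans (by rw [hσs]; rfl)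
      have h2 : (σ.liftNormal Ω) (a - b) = -(a - b) := by
        have h3 : (s : Ω) ^ 2 = (a - b) ^ 2 := hs.trans hΔ.symm
        rcases sq_eq_sq_iff_eq_or_eq_neg.1 h3 with h4 | h4
        · rw [← h4, h1]
        · rw [show a - b = -(s : Ω) by rw [h4, neg_neg], map_neg, h1]
      rcases H.apply_eq_or (σ.liftNormal Ω) with h3 | h3
      · rw [map_sub, h3.1, h3.2] at h2
        exact absurd (self_eq_neg.1 h2) (sub_ne_zero.2 H.ne)
      · exact h3.1
    · obtain rfl : z = ⟨ζ, hζL⟩ := Subtype.ext hz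
      exact (σ.liftNormal_commutes Ω ⟨ζ, hζL⟩).trans (by rw [hσz]; rfl)
    · obtain rfl : r = ⟨ρ, hρL⟩ := Subtype.ext hr
      exact (σ.liftNormal_commutes Ω ⟨ρ, hρL⟩).trans (by rw [hσr]; rfl)
  · rintro ⟨σ, hσa, hσζ, hσρ⟩
    have hσb : σ b = a := by
      rcases H.apply_eq_or σ with h1 | h1
      · exact absurd (h1.1.symm.trans hσa) H.ne
      · exact h1.2
    have hbL : b ∈ kummerField a ζ ρ := H.mem_right haL
    -- both `σ` and `σ⁻¹` map the generators into `ℚ(a, ζ, ρ)`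
    have hmap : (kummerField a ζ ρ).map (σ : Ω →ₐ[ℚ] Ω) = kummerField a ζ ρ := by
      apply le_antisymm
      · rw [kummerField, IntermediateField.adjoin_map, IntermediateField.adjoin_le_iff]
        rintro _ ⟨x, rfl | rfl | rfl, rfl⟩
        · exact hσa ▸ hbL
        · exact hσζ ▸ inv_mem hζL
        · exact hσρ ▸ inv_mem hρL
      · conv_lhs => rw [kummerField]
        rw [IntermediateField.adjoin_le_iff]
        rintro x (hx | hx | hx) <;> rw [hx]
        · exact ⟨b, hbL, hσb⟩
        · exact ⟨ζ⁻¹, (kummerField a ζ ρ).inv_mem hζL,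
            (map_inv₀ σ ζ).trans (by rw [hσζ, inv_inv])⟩
        · exact ⟨ρ⁻¹, (kummerField a ζ ρ).inv_mem hρL,
            (map_inv₀ σ ρ).trans (by rw [hσρ, inv_inv])⟩
    let f : kummerField a ζ ρ →+* kummerField a ζ ρ :=
      ((σ : Ω →+* Ω).comp (algebraMap (kummerField a ζ ρ) Ω)).codRestrict (kummerField a ζ ρ)
        fun x => hmap.le ⟨x, x.2, rfl⟩
    have hf : Function.Bijective f := by
      refine ⟨f.injective, fun y => ?_⟩
      obtain ⟨x, hx, hxy⟩ := hmap.ge y.2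
      exact ⟨⟨x, hx⟩, Subtype.ext hxy⟩
    refine ⟨(RingEquiv.ofBijective f hf).toRatAlgEquiv, ⟨a - b, sub_mem haL hbL⟩, ⟨ζ, hζL⟩,
      ⟨ρ, hρL⟩, hΔ, rfl, rfl, Subtype.ext ?_, Subtype.ext ?_, Subtype.ext ?_⟩
    · change σ (a - b) = -(a - b)
      rw [map_sub, hσa, hσb, neg_sub]
    · exact hσζ
    · exact hσρ

end Sigma

namespace IsKummerDatum

variable {Ω : Type*} [Field Ω] [Algebra ℚ Ω] [IsAlgClosure ℚ Ω] {a b γ c : Ω} {h : ℕ}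
  {ζ ρ : Ω} {m n : ℕ}

theorem pow_mem_adjoin (H : IsKummerDatum a b γ c h) (hn : 0 < n) (hζ : IsPrimitiveRoot ζ n)
    (hmn : m ∣ n) (hρ : ρ ^ m = γ) :
    ρ ^ (m / Nat.gcd m h) ∈ IntermediateField.adjoin ℚ {a, ζ} := by
  obtain ⟨ε, hε, hρε⟩ := H.exists_pow_div_gcd_eq hmn hρ
  rw [hρε]
  refine mul_mem ?_ (pow_mem ?_ _)
  · exact IntermediateField.adjoin.mono ℚ _ _ (by simp) (mem_adjoin_of_pow_eq_one hζ hn hε)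
  · exact IntermediateField.adjoin.mono ℚ _ _ (by simp) H.mem

/-- The degree of the cyclotomic-Kummer extension: `[K_{n,m} : ℚ] = 2 φ(n) m / (m, h)` if `K` is
not contained in `ℚ(ζ_n)`. -/
theorem finrank_kummerField (H : IsKummerDatum a b γ c h) (hn : 0 < n)
    (hζ : IsPrimitiveRoot ζ n) (hm : 0 < m) (hmn : m ∣ n) (hρ : ρ ^ m = γ)
    (hqm : ¬ gcdInfty h 2 ∣ m) (ha : a ∉ ℚ⟮ζ⟯) :
    Module.finrank ℚ (kummerField a ζ ρ) = 2 * n.totient * (m / Nat.gcd m h) := by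
  have : NeZero n := ⟨hn.ne'⟩
  have hρ0 : ρ ≠ 0 := by
    rintro rfl
    exact H.base_ne_zero (hρ ▸ zero_pow hm.ne')
  have hS : 0 < m / Nat.gcd m h :=
    Nat.div_pos (Nat.gcd_le_left h hm) (Nat.gcd_pos_of_pos_left h hm)
  have h1 : Nat.card {y : Ω // ∃ τ : Ω ≃ₐ[ℚ] Ω, (∀ s ∈ ({a, ζ} : Set Ω), τ s = s) ∧ τ ρ = y} =
      m / Nat.gcd m h := by
    have : NeZero (m / Nat.gcd m h) := ⟨hS.ne'⟩
    obtain ⟨z, hz⟩ := exists_isPrimitiveRoot (Ω := Ω) hS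
    rw [← hz.card_rootsOfUnity]
    have hmem : ∀ u : rootsOfUnity (m / Nat.gcd m h) Ω, ∃ τ : Ω ≃ₐ[ℚ] Ω,
        (∀ s ∈ ({a, ζ} : Set Ω), τ s = s) ∧ τ ρ = (u : Ωˣ) * ρ := by
      intro u
      obtain ⟨τ, h1, h2, h3⟩ := H.exists_algEquiv_mul hn hζ hm hmn hρ hqm
        (ε := (u : Ωˣ)) ((mem_rootsOfUnity' _ _).1 u.2)
      exact ⟨τ, by simp [h1, h2], h3⟩
    refine (Nat.card_congr (Equiv.ofBijective (fun u : rootsOfUnity (m / Nat.gcd m h) Ω =>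
      ⟨(u : Ωˣ) * ρ, hmem u⟩) ⟨?_, ?_⟩)).symm
    · intro u v huv
      exact Subtype.ext (Units.ext (mul_right_cancel₀ hρ0 (congrArg Subtype.val huv)))
    · rintro ⟨_, τ, hτ, rfl⟩
      have hu0 : τ ρ / ρ ≠ 0 := div_ne_zero ((map_ne_zero τ).2 hρ0) hρ0
      refine ⟨⟨Units.mk0 _ hu0, ?_⟩, Subtype.ext (div_mul_cancel₀ _ hρ0)⟩
      rw [mem_rootsOfUnity', Units.val_mk0, div_pow, ← map_pow,
        mem_adjoin_iff_forall_algEquiv.1 (H.pow_mem_adjoin hn hζ hmn hρ) τ hτ,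
        div_self (pow_ne_zero _ hρ0)]
  have h2 : Nat.card {y : Ω // ∃ τ : Ω ≃ₐ[ℚ] Ω, (∀ s ∈ ({ζ} : Set Ω), τ s = s) ∧ τ a = y} =
      2 := by
    have hset : {y : Ω | ∃ τ : Ω ≃ₐ[ℚ] Ω, (∀ s ∈ ({ζ} : Set Ω), τ s = s) ∧ τ a = y} = {a, b} := by
      ext y
      constructor
      · rintro ⟨τ, -, rfl⟩
        rcases H.apply_eq_or τ with h1 | h1
        · exact Or.inl h1.1
        · exact Or.inr h1.1
      · rintro (rfl | rfl)
        · exact ⟨1, fun _ _ => rfl, rfl⟩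
        · rw [mem_adjoin_simple_iff_forall_algEquiv] at ha
          push Not at ha
          obtain ⟨τ, hτζ, hτa⟩ := ha
          refine ⟨τ, by simpa using hτζ, ?_⟩
          rcases H.apply_eq_or τ with h1 | h1
          · exact absurd h1.1 hτa
          · exact h1.1
    change Nat.card {y : Ω | _} = 2
    rw [hset, Nat.card_coe_set_eq, Set.ncard_pair H.ne]
  have h3 : Nat.card {y : Ω // ∃ τ : Ω ≃ₐ[ℚ] Ω, (∀ s ∈ (∅ : Set Ω), τ s = s) ∧ τ ζ = y} =
      n.totient := by
    have hset : {y : Ω | ∃ τ : Ω ≃ₐ[ℚ] Ω, (∀ s ∈ (∅ : Set Ω), τ s = s) ∧ τ ζ = y} =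
        primitiveRoots n Ω := by
      ext y
      rw [Finset.mem_coe, mem_primitiveRoots hn]
      constructor
      · rintro ⟨τ, -, rfl⟩
        exact hζ.map_of_injective τ.injective
      · intro hy
        obtain ⟨k, -, rfl⟩ := hζ.eq_pow_of_pow_eq_one hy.pow_eq_one
        obtain ⟨τ, hτ⟩ := exists_algEquiv_pow hζ hn ((hζ.pow_iff_coprime hn k).1 hy)
        exact ⟨τ, by simp, hτ⟩
    change Nat.card {y : Ω | _} = _
    rw [hset, Nat.card_coe_set_eq, Set.ncard_coe_finset, hζ.card_primitiveRoots]
  have e1 : kummerField a ζ ρ = IntermediateField.adjoin ℚ (insert ρ {a, ζ}) := by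
    unfold kummerField
    congr 1
    ext x
    simp only [Set.mem_insert_iff, Set.mem_singleton_iff]
    tauto
  have e2 : Module.finrank ℚ (IntermediateField.adjoin ℚ (∅ : Set Ω)) = 1 := by
    rw [IntermediateField.adjoin_empty, IntermediateField.finrank_bot]
  have e3 := finrank_adjoin_insert (∅ : Set Ω) ζ
  rw [h3, e2, one_mul, insert_empty_eq] at e3
  rw [e1, finrank_adjoin_insert, h1, finrank_adjoin_insert, h2, e3]
  ring

/-- The automorphism `σ_{u,v}` exists if and only if `K` is not contained in `ℚ(ζ_n)` and `m` is
not divisible by the full power `h₂` of `2`. -/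
theorem sigmaExists_iff (H : IsKummerDatum a b γ c h) {Δ : ℤ} (hΔ : (a - b) ^ 2 = (Δ : Ω))
    (hn : 0 < n) (hζ : IsPrimitiveRoot ζ n) (hm : 0 < m) (hmn : m ∣ n) (hρ : ρ ^ m = γ) :
    SigmaExists Δ a ζ ρ ↔ a ∉ ℚ⟮ζ⟯ ∧ ¬ gcdInfty h 2 ∣ m := by
  have := charZero_of_injective_algebraMap (algebraMap ℚ Ω).injective
  have hρ0 : ρ ≠ 0 := by
    rintro rfl
    exact H.base_ne_zero (hρ ▸ zero_pow hm.ne')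
  obtain ⟨ι, κ, hκ⟩ := exists_complexConj Ω
  obtain ⟨σ₀, hσ₀⟩ := H.exists_apply_eq
  have hκa : κ a = a := H.complexConj_apply hκ hσ₀ H.mem (H.mul_apply σ₀ hσ₀)
  rw [H.toIsConjugatePair.sigmaExists_iff hΔ]
  constructor
  · rintro ⟨σ, hσa, hσζ, hσρ⟩
    have hζσ : ∀ x ∈ ℚ⟮ζ⟯, σ x = κ x := fun x hx => algEquiv_eq_of_mem_adjoin hx (by
      rintro s rfl
      rw [hσζ, complexConj_apply_of_pow_eq_one hκ hn hζ.pow_eq_one])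
    refine ⟨fun ha => ?_, fun hq => ?_⟩
    · -- on `ℚ(ζ)` the automorphism `σ` is the complex conjugation, which fixes the real field `K`
      have := hζσ a ha
      rw [hσa, hκa] at this
      exact H.ne this.symm
    · -- otherwise `σ` inverts `γ^{1/h₂}` up to roots of unity that it inverts as well, so that the
      -- odd power `c ^ (h / h₂)` has norm `1`
      set q := gcdInfty h 2 with hqdef
      have hqh : q ∣ h := gcdInfty_dvd H.ne_zero 2
      have hx0 : c ^ (h / q) ≠ 0 := pow_ne_zero _ H.root_ne_zero
      have hε : (ρ ^ (m / q) / c ^ (h / q)) ^ n = 1 := by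
        obtain ⟨k, hk⟩ := hq.trans hmn
        rw [hk, pow_mul, div_pow, ← pow_mul, ← pow_mul, Nat.div_mul_cancel hq,
          Nat.div_mul_cancel hqh, hρ, H.pow_eq, div_self H.base_ne_zero, one_pow]
      have h1 : σ (ρ ^ (m / q) / c ^ (h / q)) = (ρ ^ (m / q) / c ^ (h / q))⁻¹ := by
        rw [hζσ _ (mem_adjoin_of_pow_eq_one hζ hn hε), complexConj_apply_of_pow_eq_one hκ hn hε]
      have hc := H.mul_apply σ hσa
      have hσx : σ (c ^ (h / q)) * c ^ (h / q) = -1 := by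
        have hodd : Odd (h / q) := by
          rw [hqdef, gcdInfty_two]
          exact Nat.not_even_iff_odd.1 fun hev =>
            Nat.not_dvd_ordCompl Nat.prime_two H.ne_zero
              (by rw [Nat.factorization_def h Nat.prime_two]; exact hev.two_dvd)
        rw [map_pow, ← mul_pow, mul_comm, hc, hodd.neg_one_pow]
      rw [map_div₀, map_pow σ ρ, hσρ, inv_div] at h1
      have hy0 : ρ ^ (m / q) ≠ 0 := pow_ne_zero _ hρ0
      have hσx0 : σ (c ^ (h / q)) ≠ 0 := (map_ne_zero σ).2 hx0
      rw [inv_pow, div_eq_div_iff hσx0 hy0, inv_mul_cancel₀ hy0, mul_comm, hσx] at h1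
      exact absurd h1.symm (by norm_num)
  · rintro ⟨ha, hqm⟩
    -- an automorphism that inverts `ζ` and moves `a`, to be corrected at `ρ`
    obtain ⟨τ₀, hτζ, hτa⟩ : ∃ τ₀ : Ω ≃ₐ[ℚ] Ω, τ₀ ζ = ζ ∧ τ₀ a ≠ a := by
      rw [mem_adjoin_simple_iff_forall_algEquiv] at ha
      push Not at ha
      exact ha
    obtain ⟨σ₁, hσa, hσζ⟩ : ∃ σ₁ : Ω ≃ₐ[ℚ] Ω, σ₁ a = b ∧ σ₁ ζ = ζ⁻¹ := by
      refine ⟨τ₀ * κ, ?_, ?_⟩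
      · rw [AlgEquiv.mul_apply, hκa]
        rcases H.apply_eq_or τ₀ with h1 | h1
        · exact absurd h1.1 hτa
        · exact h1.1
      · rw [AlgEquiv.mul_apply, complexConj_apply_of_pow_eq_one hκ hn hζ.pow_eq_one, map_inv₀,
          hτζ]
    set g := Nat.gcd m h with hg
    obtain ⟨ε, hε, hρε⟩ := H.exists_pow_div_gcd_eq hmn hρ
    have hεσ : σ₁ ε = ε⁻¹ := by
      rw [algEquiv_eq_of_mem_adjoin (mem_adjoin_of_pow_eq_one hζ hn hε) (τ := κ) (by
        rintro s rfl
        rw [hσζ, complexConj_apply_of_pow_eq_one hκ hn hζ.pow_eq_one]),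
        complexConj_apply_of_pow_eq_one hκ hn hε]
    -- `h / g` is even since `h₂ ∤ m`
    have heven : Even (h / g) := by
      by_contra hodd
      apply hqm
      have hgh : g * (h / g) = h := Nat.mul_div_cancel' (Nat.gcd_dvd_right m h)
      refine dvd_trans ?_ (Nat.gcd_dvd_left m h)
      have hcop : Nat.Coprime (gcdInfty h 2) (h / g) := by
        rw [gcdInfty_two]
        exact Nat.Coprime.pow_left _ (Nat.coprime_two_left.2 (Nat.not_even_iff_odd.1 hodd))
      refine hcop.dvd_of_dvd_mul_right ?_
      rw [hgh]
      exact gcdInfty_dvd H.ne_zero 2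
    have hε0 : ε ≠ 0 := by
      rintro rfl
      rw [zero_pow hn.ne'] at hε
      exact zero_ne_one hε
    -- `σ₁ ρ` is `ρ⁻¹` up to a root of unity that Kummer theory removes
    have hη : (σ₁ ρ * ρ) ^ (m / g) = 1 := by
      rw [mul_pow, ← map_pow, hρε, map_mul, hεσ, map_pow]
      calc ε⁻¹ * σ₁ c ^ (h / g) * (ε * c ^ (h / g)) = (ε⁻¹ * ε) * (c * σ₁ c) ^ (h / g) := by
            rw [mul_pow]; ring
        _ = 1 := by rw [inv_mul_cancel₀ hε0, H.mul_apply σ₁ hσa, heven.neg_one_pow, one_mul]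
    obtain ⟨τ, h1, h2, h3⟩ := H.exists_algEquiv_mul hn hζ hm hmn hρ hqm hη
    have hη0 : σ₁ ρ * ρ ≠ 0 := mul_ne_zero ((map_ne_zero σ₁).2 hρ0) hρ0
    refine ⟨τ * σ₁, ?_, ?_, ?_⟩
    · rw [AlgEquiv.mul_apply, hσa]
      rcases H.apply_eq_or τ with h4 | h4
      · exact h4.2
      · exact absurd (h1.symm.trans h4.1) H.ne
    · rw [AlgEquiv.mul_apply, hσζ, map_inv₀, h2]
    · have hfix : τ (σ₁ ρ * ρ) = σ₁ ρ * ρ := by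
        refine mem_adjoin_simple_iff_forall_algEquiv.1
          (mem_adjoin_of_pow_eq_one hζ hn (x := σ₁ ρ * ρ) ?_) τ h2
        obtain ⟨k, hk⟩ := (Nat.div_dvd_of_dvd (Nat.gcd_dvd_left m h)).trans hmn
        rw [hk, pow_mul, hη, one_pow]
      rw [map_mul, h3] at hfix
      refine eq_inv_of_mul_eq_one_left (mul_right_cancel₀ hη0 ?_)
      rw [AlgEquiv.mul_apply]
      linear_combination hfix

end IsKummerDatum

/-! ### The quadratic field of a Lucas sequence -/

section LucasField

variable {Ω : Type*} [Field Ω] [Algebra ℚ Ω]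

theorem eq_one_or_eq_neg_one_of_mem_bot {x : Ω} (hx : x ∈ (⊥ : IntermediateField ℚ Ω)) {n : ℕ}
    (hn : n ≠ 0) (hxn : x ^ n = 1) : x = 1 ∨ x = -1 ∧ Even n := by
  obtain ⟨q, rfl⟩ := IntermediateField.mem_bot.1 hx
  rw [← map_pow, ← map_one (algebraMap ℚ Ω)] at hxn
  rcases pow_eq_one_iff_cases.1 ((algebraMap ℚ Ω).injective hxn) with h | rfl | ⟨rfl, h⟩
  · exact absurd h hn
  · exact Or.inl (map_one _)
  · exact Or.inr ⟨by rw [map_neg, map_one], h⟩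

variable {a b : Ω}

/-- A quadratic field fixed by complex conjugation is real. -/
theorem IsConjugatePair.discr_pos (H : IsConjugatePair a b) {Δ : ℤ}
    (hΔ : (a - b) ^ 2 = (Δ : Ω)) {ι : Ω →ₐ[ℚ] ℂ} {κ : Ω ≃ₐ[ℚ] Ω}
    (hκ : ∀ x, ι (κ x) = starRingEnd ℂ (ι x)) (hκa : κ a = a) : 0 < Δ := by
  have hκb : κ b = b := by
    rcases H.apply_eq_or κ with h1 | h1
    · exact h1.2
    · exact absurd (hκa.symm.trans h1.1) H.ne
  have h1 : starRingEnd ℂ (ι (a - b)) = ι (a - b) := by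
    rw [← hκ, map_sub, hκa, hκb]
  obtain ⟨r, hr⟩ := Complex.conj_eq_iff_real.1 h1
  have h2 := congrArg ι hΔ
  rw [map_pow, hr, map_intCast] at h2
  have h3 : r ^ 2 = (Δ : ℝ) := by exact_mod_cast h2
  have hr0 : r ≠ 0 := by
    rintro rfl
    rw [Complex.ofReal_zero] at hr
    exact H.ne (sub_eq_zero.1 ((map_eq_zero ι).1 hr))
  have h4 : (0 : ℝ) < Δ := h3 ▸ by positivity
  exact_mod_cast h4

variable [IsAlgClosure ℚ Ω]

/-- As `γ = a / b` has norm `1`, a root of `γ` in `K` has norm `±1`; the hypothesis on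
`γ^{1/h₂}` selects the sign. -/
theorem IsConjugatePair.exists_isKummerDatum (H : IsConjugatePair a b) {γ : Ω} (hγ : γ = a / b)
    {h : ℕ} (hh : h = powerIndex ℚ⟮a⟯ γ) (hQ : ¬ RootHasNormOne ℚ⟮a⟯ γ (gcdInfty h 2)) :
    ∃ c, IsKummerDatum a b γ c h := by
  have haK : a ∈ ℚ⟮a⟯ := IntermediateField.mem_adjoin_simple_self ℚ a
  have ha0 : a ≠ 0 := fun h0 => H.not_mem_bot (h0 ▸ zero_mem _)
  obtain ⟨σ, hσ⟩ := H.exists_apply_eq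
  have hσb : σ b = a := by
    rcases H.apply_eq_or σ with h1 | h1
    · exact absurd (h1.1.symm.trans hσ) H.ne
    · exact h1.2
  have hb0 : b ≠ 0 := by
    rw [← hσ]; exact (map_ne_zero σ).2 ha0
  have hγ0 : γ ≠ 0 := hγ ▸ div_ne_zero ha0 hb0
  have hγK : γ ∈ ℚ⟮a⟯ := hγ ▸ div_mem haK (H.mem_right haK)
  have hγσ : γ * σ γ = 1 := by
    rw [hγ, map_div₀, hσ, hσb]
    field_simp
  have hnorm : ∀ x (hx : x ∈ ℚ⟮a⟯), x ^ gcdInfty h 2 = γ → x * σ x ≠ 1 := by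
    intro x hx hxγ hcon
    refine hQ ⟨⟨x, hx⟩, hxγ, (algebraMap ℚ Ω).injective ?_⟩
    rw [H.norm_eq rfl _ hσ, map_one]
    exact hcon
  -- `h = 0` would give `h₂ = 1`, while `γ` itself has norm `1`
  have h0 : h ≠ 0 := by
    intro h0
    refine hnorm γ hγK ?_ hγσ
    rw [h0, gcdInfty_two, show padicValNat 2 0 = 0 by simp, pow_zero, pow_one]
  obtain ⟨⟨c, hc, hch⟩, hdvd⟩ := powerIndex_spec hγ0 hh h0
  have hcbot : c * σ c ∈ (⊥ : IntermediateField ℚ Ω) := by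
    rw [H.mem_bot_iff (mul_mem hc (H.apply_mem hc σ)) hσ, map_mul, H.apply_apply hc hσ hσ,
      mul_comm]
  have hch1 : (c * σ c) ^ h = 1 := by rw [mul_pow, ← map_pow, hch, hγσ]
  have hne1 : c * σ c ≠ 1 := by
    intro h1
    have hq : gcdInfty h 2 ∣ h := gcdInfty_dvd h0 2
    refine hnorm (c ^ (h / gcdInfty h 2)) (pow_mem hc _) ?_ ?_
    · rw [← pow_mul, Nat.div_mul_cancel hq, hch]
    · rw [map_pow, ← mul_pow, h1, one_pow]
  obtain ⟨hcσ, heven⟩ := (eq_one_or_eq_neg_one_of_mem_bot hcbot h0 hch1).resolve_left hne1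
  refine ⟨c, { H with
    mem := hc, pow_eq := hch, ne_zero := h0, two_dvd := heven.two_dvd, dvd_of_pow_eq := hdvd,
    mul_apply := fun τ hτ => ?_ }⟩
  rw [algEquiv_eq_of_mem_adjoin hc (σ := τ) (τ := σ) (by rintro s rfl; rw [hτ, hσ]), hcσ]

/-- The conductor of a real quadratic field `ℚ(a)` is its discriminant. -/
theorem IsConjugatePair.mem_adjoin_iff_discr_dvd (H : IsConjugatePair a b) {Δ : ℤ}
    (hΔ : (a - b) ^ 2 = (Δ : Ω)) (hpos : 0 < Δ) {n : ℕ} (hn : 0 < n) (hn2 : 2 ∣ n) {ζ : Ω}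
    (hζ : IsPrimitiveRoot ζ n) :
    a ∈ ℚ⟮ζ⟯ ↔ (NumberField.discr ℚ⟮a⟯).natAbs ∣ n := by
  have := charZero_of_injective_algebraMap (algebraMap ℚ Ω).injective
  have haK : a ∈ ℚ⟮a⟯ := IntermediateField.mem_adjoin_simple_self ℚ a
  obtain ⟨σ, hσ⟩ := H.exists_apply_eq
  have hσb : σ b = a := by
    rcases H.apply_eq_or σ with h1 | h1
    · exact absurd (h1.1.symm.trans hσ) H.ne
    · exact h1.2
  obtain ⟨N, rfl⟩ := Int.eq_ofNat_of_zero_le hpos.le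
  obtain ⟨D, f, -, hf0, hDf, hD⟩ := Nat.sq_mul_squarefree_of_pos (n := N) (by exact_mod_cast hpos)
  have hf : (f : Ω) ≠ 0 := Nat.cast_ne_zero.2 hf0.ne'
  set r := (a - b) / f with hr
  have hr2 : r ^ 2 = (D : Ω) := by
    rw [hr, div_pow, hΔ, ← hDf]
    push_cast
    field_simp
  have hrK : r ∈ ℚ⟮a⟯ := div_mem (sub_mem haK (H.mem_right haK)) (natCast_mem _ f)
  have hσr : σ r = -r := by
    rw [hr, map_div₀, map_sub, hσ, hσb, map_natCast]
    ring
  have hr0 : r ≠ 0 := div_ne_zero (sub_ne_zero.2 H.ne) hf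
  -- the coordinates of `x` are `(x + σ x) / 2` and `(x - σ x) / (2 r)`
  have hspan : ∀ x : ℚ⟮a⟯, ∃ p q : ℚ,
      x = algebraMap ℚ ℚ⟮a⟯ p + algebraMap ℚ ℚ⟮a⟯ q * ⟨r, hrK⟩ := by
    rintro ⟨x, hx⟩
    have hσx := H.apply_mem hx σ
    have h1 : (x + σ x) / 2 ∈ (⊥ : IntermediateField ℚ Ω) := by
      rw [H.mem_bot_iff (div_mem (add_mem hx hσx) (ofNat_mem _ 2)) hσ, map_div₀, map_add,
        H.apply_apply hx hσ hσ, map_ofNat, add_comm]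
    have h2 : (x - σ x) / (2 * r) ∈ (⊥ : IntermediateField ℚ Ω) := by
      rw [H.mem_bot_iff (div_mem (sub_mem hx hσx) (mul_mem (ofNat_mem _ 2) hrK)) hσ, map_div₀,
        map_sub, H.apply_apply hx hσ hσ, map_mul, map_ofNat, hσr, mul_neg, div_neg, ← neg_div,
        neg_sub]
    obtain ⟨p, hp⟩ := IntermediateField.mem_bot.1 h1
    obtain ⟨q, hq⟩ := IntermediateField.mem_bot.1 h2
    refine ⟨p, q, (algebraMap ℚ⟮a⟯ Ω).injective ?_⟩
    rw [map_add, map_mul, eq_ratCast, eq_ratCast, map_ratCast, map_ratCast]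
    rw [eq_ratCast] at hp hq
    rw [hp, hq]
    change x = _ + _ * r
    field_simp
    ring
  have hrat : ∀ q : ℚ, algebraMap ℚ ℚ⟮a⟯ q ≠ ⟨r, hrK⟩ := by
    intro q hq
    have h1 := congrArg (algebraMap ℚ⟮a⟯ Ω) hq
    rw [eq_ratCast, map_ratCast] at h1
    have h2 : σ r = r := by
      rw [show r = (q : Ω) from h1.symm, map_ratCast]
    rw [hσr] at h2
    exact hr0 (self_eq_neg.1 h2.symm)
  rw [natAbs_discr_eq_quadraticDiscr hD (r := ⟨r, hrK⟩) (Subtype.ext (by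
    change r ^ 2 = ((D : ℚ⟮a⟯) : Ω)
    rw [hr2]; rfl)) hspan hrat, ← sqrt_mem_adjoin_iff_quadraticDiscr_dvd hD hn hn2 hr2 hζ]
  have hsum : a + b ∈ ℚ⟮ζ⟯ := (bot_le : ⊥ ≤ ℚ⟮ζ⟯) H.add_mem_bot
  constructor
  · exact fun ha => div_mem (sub_mem ha (H.mem_right ha)) (natCast_mem _ f)
  · intro h1
    have h2 : a = ((a + b) + f * r) / 2 := by
      rw [hr]; field_simp; ring
    rw [h2]
    exact div_mem (add_mem hsum (mul_mem (natCast_mem _ f) h1)) (ofNat_mem _ 2)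

/-- The roots of an irreducible quadratic polynomial form a conjugate pair. -/
theorem isConjugatePair_of_aroots {a₁ a₂ : ℤ} (hirr : Irreducible (charPoly a₁ a₂))
    (hab : (charPoly a₁ a₂).aroots Ω = {a, b}) :
    IsConjugatePair a b ∧ (a - b) ^ 2 = ((a₁ ^ 2 - 4 * a₂ : ℤ) : Ω) := by
  have := IsAlgClosure.isAlgClosed ℚ (K := Ω)
  have hdeg : (charPoly a₁ a₂).natDegree = 2 := by
    unfold charPoly; compute_degree!
  have hmonic : (charPoly a₁ a₂).Monic := by
    unfold charPoly; monicity!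
  have hprod := (IsAlgClosed.splits ((charPoly a₁ a₂).map (algebraMap ℚ Ω))).eq_prod_roots_of_monic
    (hmonic.map _)
  rw [← Polynomial.aroots_def, hab] at hprod
  have heval : ∀ x : Ω, x ^ 2 - a₁ * x + a₂ = (x - a) * (x - b) := by
    intro x
    have h1 := congrArg (Polynomial.eval x) hprod
    simpa [charPoly] using h1
  -- the values of the polynomial at `0` and `1`
  have h0 : a * b = a₂ := by
    linear_combination -heval 0
  have hsum : a + b = a₁ := by
    linear_combination heval 1 + h0
  refine ⟨⟨fun ha => ?_, ?_, ?_⟩, ?_⟩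
  · obtain ⟨q, rfl⟩ := IntermediateField.mem_bot.1 ha
    have hroot : (charPoly a₁ a₂).IsRoot q := by
      have h1 := heval (algebraMap ℚ Ω q)
      rw [sub_self, zero_mul] at h1
      refine (algebraMap ℚ Ω).injective (Eq.trans ?_ (h1.trans (map_zero _).symm))
      simp only [charPoly, Polynomial.eval_add, Polynomial.eval_sub, Polynomial.eval_pow,
        Polynomial.eval_mul, Polynomial.eval_X, Polynomial.eval_intCast, map_add, map_sub, map_pow,
        map_mul, map_intCast]
    have h1 := Polynomial.natDegree_eq_of_degree_eq_some (n := 1)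
      (Polynomial.degree_eq_one_of_irreducible_of_root hirr hroot)
    omega
  · exact hsum ▸ intCast_mem _ a₁
  · exact h0 ▸ intCast_mem _ a₂
  · push_cast
    linear_combination (a + b + a₁) * hsum - 4 * h0


end LucasField

/-! ### The terms of the series -/

/-- The term of `δ⁻` at `v`: if `e ∣ v`, then `K ⊆ ℚ(ζ_{dv})` and no `σ_{u,v}` exists; otherwise
`[K_{dv,uv} : ℚ] = 2 v φ(d) u v / (u v, h)` whenever `h₂ ∤ u v`. -/
theorem IsKummerDatum.deltaMinusTerm_eq {Ω : Type*} [Field Ω] [Algebra ℚ Ω] [IsAlgClosure ℚ Ω]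
    {a b γ c : Ω} {h : ℕ} (H : IsKummerDatum a b γ c h) {Δ : ℤ} (hΔ : (a - b) ^ 2 = (Δ : Ω))
    (hpos : 0 < Δ) {zeta root : ℕ → Ω} (hzeta : ∀ n : ℕ, 0 < n → IsPrimitiveRoot (zeta n) n)
    (hroot : ∀ n : ℕ, 0 < n → root n ^ n = γ) {d v e : ℕ} (hd : 0 < d) (hd2 : 2 ∣ d)
    (hv : DvdInfty v d)
    (he : e = (NumberField.discr ℚ⟮a⟯).natAbs / Nat.gcd d (NumberField.discr ℚ⟮a⟯).natAbs) :
    deltaMinusTerm Δ a zeta root d v =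
      if e ∣ v then 0 else if gcdInfty h d ∣ 2 * v ∧ ¬ gcdInfty h 2 ∣ v then
        (gcdInfty h d : ℝ) / (2 * d * (v : ℝ) ^ 2) else 0 := by
  classical
  have hv0 : 0 < v := hv.1
  have hn : 0 < d * v := Nat.mul_pos hd hv0
  have hz := hzeta _ hn
  have hdvd : (NumberField.discr ℚ⟮a⟯).natAbs ∣ d * v ↔ e ∣ v := by
    rw [he, Nat.gcd_comm, Nat.div_dvd_iff_dvd_mul (Nat.gcd_dvd_left _ d)
      (Nat.gcd_pos_of_pos_right _ hd), Nat.dvd_gcd_mul_iff_dvd_mul]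
  have haz : a ∈ ℚ⟮zeta (d * v)⟯ ↔ e ∣ v :=
    (H.mem_adjoin_iff_discr_dvd hΔ hpos hn (hd2.mul_right v) hz).trans hdvd
  have hiff : ∀ u ∈ d.divisors, (SigmaExists Δ a (zeta (d * v)) (root (u * v)) ↔
      ¬ e ∣ v ∧ ¬ gcdInfty h 2 ∣ u * v) := fun u hu => by
    have hm : 0 < u * v := Nat.mul_pos (Nat.pos_of_mem_divisors hu) hv0
    rw [H.sigmaExists_iff hΔ hn hz hm (Nat.mul_dvd_mul_right (Nat.dvd_of_mem_divisors hu) v)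
      (hroot _ hm), haz]
  unfold deltaMinusTerm
  by_cases hev : e ∣ v
  · rw [if_pos hev]
    refine Finset.sum_eq_zero fun u hu => ?_
    rw [if_neg (fun hs => ((hiff u hu).1 hs).1 hev), mul_zero, zero_div]
  rw [if_neg hev]
  have hφ : (0 : ℝ) < d.totient := by exact_mod_cast Nat.totient_pos.2 hd
  have hvR : (0 : ℝ) < v := by exact_mod_cast hv0
  have hdR : (0 : ℝ) < d := by exact_mod_cast hd
  have hterm : ∀ u ∈ d.divisors, (ArithmeticFunction.moebius u : ℝ) *
        (if SigmaExists Δ a (zeta (d * v)) (root (u * v)) then 1 else 0) /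
      (Module.finrank ℚ (kummerField a (zeta (d * v)) (root (u * v))) : ℝ) =
      1 / (2 * d.totient * (v : ℝ) ^ 2) * ((ArithmeticFunction.moebius u : ℝ) *
        (if gcdInfty h 2 ∣ u * v then 0 else (Nat.gcd (u * v) h : ℝ) / u)) := fun u hu => by
    by_cases hq : gcdInfty h 2 ∣ u * v
    · rw [if_pos hq, if_neg (fun hs => ((hiff u hu).1 hs).2 hq)]
      simp
    · have hu0 : 0 < u := Nat.pos_of_mem_divisors hu
      have hm : 0 < u * v := Nat.mul_pos hu0 hv0
      have huR : (0 : ℝ) < u := by exact_mod_cast hu0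
      have hg : 0 < Nat.gcd (u * v) h := Nat.gcd_pos_of_pos_left h hm
      have hgR : (0 : ℝ) < Nat.gcd (u * v) h := by exact_mod_cast hg
      rw [if_neg hq, if_pos ((hiff u hu).2 ⟨hev, hq⟩),
        H.finrank_kummerField hn hz hm (Nat.mul_dvd_mul_right (Nat.dvd_of_mem_divisors hu) v)
          (hroot _ hm) hq (fun ha => hev (haz.1 ha)), totient_mul_of_dvdInfty hv]
      push_cast [Nat.cast_div (Nat.gcd_dvd_left (u * v) h) hgR.ne']
      field_simp
  rw [Finset.sum_congr rfl hterm, ← Finset.mul_sum,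
    sum_divisors_moebius_gcd H.ne_zero hd.ne' hd2 hv]
  split_ifs
  · field_simp
  · rw [mul_zero]

end LucasRank

open LucasRank in
open Classical in
theorem mainTheorem2
    -- an algebraic closure of `ℚ`
    {Ω : Type*} [Field Ω] [Algebra ℚ Ω] [IsAlgClosure ℚ Ω]
    -- the Lucas sequence, the roots of its characteristic polynomial and their quotient
    (a₁ a₂ : ℤ) (ha₁ : a₁ ≠ 0) (ha₂ : a₂ ≠ 0)
    (hirr : Irreducible (charPoly a₁ a₂))
    (a b : Ω) (hab : (charPoly a₁ a₂).aroots Ω = {a, b})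
    (γ : Ω) (hγ : γ = a / b) (hγ_unity : ∀ n : ℕ, 0 < n → γ ^ n ≠ 1)
    -- arbitrary choices of `ζ_n` and of `γ^{1/n}`
    (zeta root : ℕ → Ω)
    (hzeta : ∀ n : ℕ, 0 < n → IsPrimitiveRoot (zeta n) n)
    (hroot : ∀ n : ℕ, 0 < n → root n ^ n = γ)
    -- `h`, with the standing assumption `h = h(1)`
    (h : ℕ) (hh : h = maxPowerIndex ℚ⟮a⟯ γ) (hh1 : h = powerIndex ℚ⟮a⟯ γ)
    -- `N_{K/ℚ}(γ^{1/h_2}) ≠ 1`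
    (hQ : ¬ RootHasNormOne ℚ⟮a⟯ γ (gcdInfty h 2))
    (d : ℕ) (hd : 0 < d) (hd2 : 2 ∣ d)
    (e : ℕ)
    (he : e = (NumberField.discr ℚ⟮a⟯).natAbs / Nat.gcd d (NumberField.discr ℚ⟮a⟯).natAbs) :
    Summable (fun v : {v : ℕ // DvdInfty v d} =>
        deltaMinusTerm (a₁ ^ 2 - 4 * a₂) a zeta root d v) ∧
    deltaMinus (a₁ ^ 2 - 4 * a₂) a zeta root d =
      3 / (2 * (d : ℝ)) *
        (1 / (gcdInfty h d : ℝ) -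
          (if DvdInfty e d ∧ ¬ gcdInfty h 2 ∣ e then 1 else 0) *
            ((gcdInfty h d : ℝ) / (Nat.lcm (gcdInfty h d) e : ℝ) ^ 2)) *
        ∏ p ∈ d.primeFactors, ((p : ℝ) ^ 2 / ((p : ℝ) ^ 2 - 1)) := by
  obtain ⟨H, hΔ⟩ := isConjugatePair_of_aroots hirr hab
  obtain ⟨c, Hc⟩ := H.exists_isKummerDatum hγ hh1 hQ
  obtain ⟨ι, κ, hκ⟩ := exists_complexConj Ω
  obtain ⟨σ, hσ⟩ := H.exists_apply_eq
  have hpos := H.discr_pos hΔ hκ (H.complexConj_apply hκ hσ Hc.mem (Hc.mul_apply σ hσ))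
  have he0 : e ≠ 0 := by
    have hdisc : (NumberField.discr ℚ⟮a⟯).natAbs ≠ 0 :=
      Int.natAbs_ne_zero.2 (NumberField.discr_ne_zero _)
    rw [he]
    exact (Nat.div_pos (Nat.gcd_le_right d (Nat.pos_of_ne_zero hdisc))
      (Nat.gcd_pos_of_pos_left _ hd)).ne'
  have hsum := hasSum_not_dvd_inv_sq Hc.two_dvd Hc.ne_zero hd.ne' hd2 he0
  have hterm : (fun v : {v : ℕ // DvdInfty v d} =>
      deltaMinusTerm (a₁ ^ 2 - 4 * a₂) a zeta root d v) = _ :=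
    funext fun v => Hc.deltaMinusTerm_eq hΔ hpos hzeta hroot hd hd2 v.2 he
  rw [← hterm] at hsum
  exact ⟨hsum.summable, hsum.tsum_eq⟩
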